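/- Let $d\ge 1$, write $B_K=\{p\in\mathbb R^d:|p|<K\}$, and let $H=H(p,y)\in C(\mathbb R^d\times\mathbb R^d)$ satisfy: (a) for every $K>0$, $H$ is uniformly continuous on $B_K\times\mathbb R^d$ and $\{H(\cdot,y):y\in\mathbb R^d\}$ is bounded in $C^{0,1}(B_K)$ (uniform bounds on the supremum and on the Lipschitz constant); (b) $\lim_{|p|\to\infty}\inf_{y}H(p,y)=+\infty$. No convexity of $H$ is assumed. Call $H$ *almost periodic* if (c) for every $K>0$, $\{H(\cdot,\cdot+y):y\in\mathbb R^d\}$ is precompact for uniform convergence on $B_K\times\mathbb R^d$. For $K,R,\delta>0$ put $$\rho_K(R)=\sup_{y\in\mathbb R^d}\ \inf_{z\in B_R}\ \sup_{(p,x)\in B_K\times\mathbb R^d}|H(p,x+y)-H(p,x+z)|,\qquad \eta_K(\delta)=4\inf\Big\{s>0:\rho_K\Big(\frac{s}{K\delta}\Big)\le s\Big\},$$ $$L(K)=\sup\Big\{|q|:\ \inf_{y}H(q,y)\le\sup_{(p,y)\in B_K\times\mathbb R^d}H(p,y)\Big\}.$$ Differential equations are understood in the viscosity sense. Suppose that (a),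 (b), (c) hold. Then for all $\delta>0$ and $p\in\mathbb R^d$ the equation $\delta v+H(p+Dv,y)=0$ in $\mathbb R^d$ has a unique bounded uniformly continuous solution $v^\delta(\cdot\,;p)$, and there is a (necessarily unique) $\overline H\in C(\mathbb R^d)$, the effective Hamiltonian, with $\lim_{\delta\to0^+}\sup_{y}|\delta v^\delta(y;p)+\overline H(p)|=0$ for every $p$. Moreover, for every $K>0$, with $L=L(K)$, one has $\eta_L(\delta)\to0$ as $\delta\to0^+$, and there is a constant $C>0$, depending only on $H$ and $K$, such that the following holds. Let $T\ge1$, $\varepsilon>0$, let $u_0:\mathbb R^d\to\mathbb R$ be Lipschitz, and let $u^\varepsilon,u$ be solutions of $$u^\varepsilon_t+H\Big(Du^\varepsilon,\frac x\varepsilon\Big)=0,\qquad u_t+\overline H(Du)=0\qquad\text{in }\mathbb R^d\times(0,T),$$ with $u^\varepsilon(x,0)=u(x,0)=u_0(x)$ and, for all $x,y\in\mathbb R^d$ and $s,t\in[0,T]$, $$\max\{|u^\varepsilon(x,t)-u^\varepsilon(y,s)|,\ |u(x,t)-u(y,s)|\}\le K(|x-y|+|t-s|).$$ Then $$\sup_{(x,t)\in\mathbb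 R^d\times[0,T]}|u^\varepsilon(x,t)-u(x,t)|\le C\,T\big(\varepsilon^{1/3}+\eta_L(\varepsilon^{1/3})\big).$$ Finally, if (a), (b) hold and $y\mapsto H(p,y)$ is $\mathbb Z^d$-periodic for every $p$, then (c) holds and, for every $K>0$, there is $C>0$, depending only on $H$ and $K$, such that for all $T,\varepsilon,u_0,u^\varepsilon,u$ as above $$\sup_{(x,t)\in\mathbb R^d\times[0,T]}|u^\varepsilon(x,t)-u(x,t)|\le C\,T\,\varepsilon^{1/3}.$$ -/

import Mathlib

open Set Filter Topology Metric

noncomputable section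

namespace HJ

/-- The Euclidean space `ℝ^d` (with the Euclidean norm). -/
abbrev Rd (d : ℕ) : Type := EuclideanSpace ℝ (Fin d)

variable {d : ℕ}

/-! ### Assumptions on a Hamiltonian `H = H(p, y)` -/

/-- For each `K > 0`, `H` is uniformly continuous on `B_K × ℝ^d` and the family
`{H(·, y) : y ∈ ℝ^d}` is bounded in `C^{0,1}(B_K)`. -/
def IsRegular (H : Rd d → Rd d → ℝ) : Prop :=
  ∀ K : ℝ, 0 < K →
    UniformContinuousOn (fun q : Rd d × Rd d => H q.1 q.2) (ball 0 K ×ˢ univ) ∧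
    ∃ M : ℝ, ∀ y : Rd d,
      (∀ p ∈ ball (0 : Rd d) K, |H p y| ≤ M) ∧
      (∀ p ∈ ball (0 : Rd d) K, ∀ q ∈ ball (0 : Rd d) K, |H p y - H q y| ≤ M * ‖p - q‖)

/-- `inf_y H(p, y) → +∞` as `|p| → ∞`. -/
def IsCoercive (H : Rd d → Rd d → ℝ) : Prop :=
  ∀ M : ℝ, ∃ R : ℝ, ∀ p : Rd d, R ≤ ‖p‖ → ∀ y : Rd d, M ≤ H p y

/-- For each `K > 0`, the family of translations `{H(·, · + y) : y ∈ ℝ^d}` is precompact for the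
topology of uniform convergence on `B_K × ℝ^d`. -/
def IsAlmostPeriodic (H : Rd d → Rd d → ℝ) : Prop :=
  ∀ K : ℝ, 0 < K →
    IsCompact (closure (range fun y : Rd d =>
      UniformFun.ofFun fun q : ball (0 : Rd d) K × Rd d => H q.1 (q.2 + y)))

/-- `y ↦ H(p, y)` is `ℤ^d`-periodic for every `p`. -/
def IsPeriodic (H : Rd d → Rd d → ℝ) : Prop :=
  ∀ (p y : Rd d) (k : Fin d → ℤ), H p (y + WithLp.toLp 2 fun i => (k i : ℝ)) = H p y

/-! ### The modulus of almost periodicity -/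

/-- `ρ_K(R) = sup_y inf_{z ∈ B_R} sup_{(p, x) ∈ B_K × ℝ^d} |H(p, x + y) - H(p, x + z)|`. -/
def rho (H : Rd d → Rd d → ℝ) (K R : ℝ) : ℝ :=
  ⨆ y : Rd d, ⨅ z : ball (0 : Rd d) R, ⨆ q : ball (0 : Rd d) K × Rd d,
    |H q.1 (q.2 + y) - H q.1 (q.2 + z)|

/-- `η_K(δ) = 4 inf {s > 0 : ρ_K(s / (K δ)) ≤ s}`. -/
def eta (H : Rd d → Rd d → ℝ) (K δ : ℝ) : ℝ :=
  4 * sInf {s : ℝ | 0 < s ∧ rho H K (s / (K * δ)) ≤ s}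

/-- `L(K) = sup {|q| : inf_y H(q, y) ≤ sup_{(p, y) ∈ B_K × ℝ^d} H(p, y)}`. -/
def gradBound (H : Rd d → Rd d → ℝ) (K : ℝ) : ℝ :=
  sSup {r : ℝ | ∃ q : Rd d, r = ‖q‖ ∧
    (⨅ y : Rd d, H q y) ≤ ⨆ a : ball (0 : Rd d) K × Rd d, H a.1 a.2}

/-! ### Viscosity solutions -/

/-- `v` is a bounded, uniformly continuous viscosity solution of the approximate cell problem
`δ v + H(p + Dv, y) = 0` in `ℝ^d`. -/
structure IsCellSolution (H : Rd d → Rd d → ℝ) (δ : ℝ) (p : Rd d) (v : Rd d → ℝ) : Prop where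
  bounded : ∃ M : ℝ, ∀ y, |v y| ≤ M
  uniformContinuous : UniformContinuous v
  subsolution : ∀ φ : Rd d → ℝ, ContDiff ℝ 1 φ → ∀ y : Rd d,
    IsLocalMax (fun z => v z - φ z) y → δ * v y + H (p + gradient φ y) y ≤ 0
  supersolution : ∀ φ : Rd d → ℝ, ContDiff ℝ 1 φ → ∀ y : Rd d,
    IsLocalMin (fun z => v z - φ z) y → 0 ≤ δ * v y + H (p + gradient φ y) y

/-- `Hbar` is the effective Hamiltonian: for every `p`, the bounded, uniformly continuous solutions
`v^δ(·; p)` of the approximate cell problem satisfy `δ v^δ(y; p) → -Hbar(p)` as `δ → 0+`, uniformly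
in `y ∈ ℝ^d`. -/
def IsEffectiveHamiltonian (H : Rd d → Rd d → ℝ) (Hbar : Rd d → ℝ) : Prop :=
  ∀ p : Rd d, ∃ v : ℝ → Rd d → ℝ,
    (∀ δ : ℝ, 0 < δ → IsCellSolution H δ p (v δ)) ∧
    TendstoUniformly (fun (δ : ℝ) (y : Rd d) => δ * v δ y) (fun _ => -Hbar p) (𝓝[>] 0)

/-- `u = u(x, t)` is a viscosity solution of `u_t + G(Du, x) = 0` in `ℝ^d × (0, T)`. The continuity
of `u` is required separately. -/
structure IsHJSolution (G : Rd d → Rd d → ℝ) (T : ℝ) (u : Rd d → ℝ → ℝ) : Prop where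
  subsolution : ∀ φ : Rd d × ℝ → ℝ, ContDiff ℝ 1 φ → ∀ (x : Rd d) (t : ℝ), 0 < t → t < T →
    IsLocalMax (fun z : Rd d × ℝ => u z.1 z.2 - φ z) (x, t) →
    deriv (fun s => φ (x, s)) t + G (gradient (fun y => φ (y, t)) x) x ≤ 0
  supersolution : ∀ φ : Rd d × ℝ → ℝ, ContDiff ℝ 1 φ → ∀ (x : Rd d) (t : ℝ), 0 < t → t < T →
    IsLocalMin (fun z : Rd d × ℝ => u z.1 z.2 - φ z) (x, t) →
    0 ≤ deriv (fun s => φ (x, s)) t + G (gradient (fun y => φ (y, t)) x) x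

/-- `u` is Lipschitz on `ℝ^d × [0, T]` with constant `K`:
`|u(x, t) - u(y, s)| ≤ K (|x - y| + |t - s|)`. -/
def IsLipschitzOnStrip (K T : ℝ) (u : Rd d → ℝ → ℝ) : Prop :=
  ∀ x y : Rd d, ∀ t ∈ Icc (0 : ℝ) T, ∀ s ∈ Icc (0 : ℝ) T,
    |u x t - u y s| ≤ K * (‖x - y‖ + |t - s|)

/-- `uε` and `u` are `K`-Lipschitz solutions, on `ℝ^d × [0, T]` and with the same Lipschitz initial
datum `u₀`, of `uε_t + H(Duε, x / ε) = 0` and `u_t + Hbar(Du) = 0` respectively. -/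
structure IsSolutionPair (H : Rd d → Rd d → ℝ) (Hbar : Rd d → ℝ) (K T ε : ℝ)
    (u₀ : Rd d → ℝ) (uε u : Rd d → ℝ → ℝ) : Prop where
  initial_lipschitz : ∃ k : NNReal, LipschitzWith k u₀
  initial_eps : ∀ x, uε x 0 = u₀ x
  initial_hom : ∀ x, u x 0 = u₀ x
  lipschitz_eps : IsLipschitzOnStrip K T uε
  lipschitz_hom : IsLipschitzOnStrip K T u
  solution_eps : IsHJSolution (fun p x => H p (ε⁻¹ • x)) T uε
  solution_hom : IsHJSolution (fun p _ => Hbar p) T u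

end HJ

end

/-! Formally `uε(x, t) ≈ u(x, t) + ε v(x / ε)`, where `v` solves a cell problem at slope `Du`. Here
`v` is the discounted solution `v^δ(·; p)`, for which `δ v^δ` is only close to `-Hbar(p)`. Two
things must be quantified: this closeness, and the error made by inserting `v^δ` into a
doubling-of-variables argument.

Cell problem. Comparison and Perron's method give existence and uniqueness, and coercivity makes
solutions Lipschitz, with slopes `p + Dv` bounded by `L`. Comparison between different discounts
(`IsCellSolution.interlace`) places `-Hbar(p)` between the infimum and the supremum of `δ v^δ` for
every `δ`, so the error is at most the oscillation of `δ v^δ`. If `ρ_L(s / (L δ)) ≤ s`, any `y` can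
be traded for some `z` with `|z| < s / (L δ)` at cost `O(s)`, and the Lipschitz bound moves `z` to
`0` at cost `O(s)` as well (`IsCellSolution.osc_le`). Optimising over `s` gives `|δ v^δ + Hbar| ≤ 3
η_L(δ)`.

Rate. Since `v^δ` is only Lipschitz in `p`, with constant `M / δ`, it cannot be differentiated along
`p = (x - y) / b`. The slope therefore becomes an independent variable of the doubled function, tied
to `(x - y) / b` by a quadratic penalty. At a maximum, the gap between `p` and `(x - y) / b` is `O(ε
/ δ)`, and the penalty perturbs the gradients by `1 / b` times the gap, that is `O(ε / (b δ))`
(`IsDoubledMax.norm_slope_sub_le`). Doubling itself costs `O(b)`. The choice `δ = b`, `ε = b ^ 3`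
balances these errors at `b = ε^{1/3}`, leaving `b + η_L(b)` (`IsDoubledMax.slope_le`,
`sub_le_of_correctors`).

The opposite inequality follows from the reflection `(p, u) ↦ (-p, -u)`, which needs no convexity.
In the periodic case translates match exactly within distance `√d`, so `η_L(δ) = O(δ)` and is
absorbed. -/

noncomputable section

namespace HJ

variable {d : ℕ}

/-! ### Test functions and their gradients -/

/-- `f` is `C^1` with gradient `g`. -/
structure HasSmoothGradient (f : Rd d → ℝ) (g : Rd d → Rd d) : Prop where
  contDiff : ContDiff ℝ 1 f
  hasGradientAt : ∀ x, HasGradientAt f (g x) x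

namespace HasSmoothGradient

variable {f f₁ f₂ : Rd d → ℝ} {g g₁ g₂ : Rd d → Rd d}

lemma gradient_eq (h : HasSmoothGradient f g) (x : Rd d) : gradient f x = g x :=
  (h.hasGradientAt x).gradient

lemma of_contDiff (h : ContDiff ℝ 1 f) : HasSmoothGradient f (gradient f) :=
  ⟨h, fun x => (h.differentiable (by norm_num) x).hasGradientAt⟩

lemma continuous (h : HasSmoothGradient f g) : Continuous g := by
  have h1 : g = fun x => (InnerProductSpace.toDual ℝ (Rd d)).symm (fderiv ℝ f x) := by
    funext x
    exact (h.gradient_eq x).symm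
  rw [h1]
  exact (LinearIsometryEquiv.continuous _).comp (h.contDiff.continuous_fderiv (by norm_num))

lemma add (h₁ : HasSmoothGradient f₁ g₁) (h₂ : HasSmoothGradient f₂ g₂) :
    HasSmoothGradient (fun x => f₁ x + f₂ x) (fun x => g₁ x + g₂ x) := by
  refine ⟨h₁.contDiff.add h₂.contDiff, fun x => ?_⟩
  have := (h₁.hasGradientAt x).hasFDerivAt.add (h₂.hasGradientAt x).hasFDerivAt
  rw [← map_add] at this
  exact hasGradientAt_iff_hasFDerivAt.2 this

lemma const_mul (h : HasSmoothGradient f g) (c : ℝ) :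
    HasSmoothGradient (fun x => c * f x) (fun x => c • g x) := by
  refine ⟨contDiff_const.mul h.contDiff, fun x => ?_⟩
  have := (h.hasGradientAt x).hasFDerivAt.const_mul c
  rw [hasGradientAt_iff_hasFDerivAt, map_smulₛₗ]
  exact this

lemma neg (h : HasSmoothGradient f g) :
    HasSmoothGradient (fun x => - f x) (fun x => - g x) := by
  simpa using h.const_mul (-1)

lemma sub (h₁ : HasSmoothGradient f₁ g₁) (h₂ : HasSmoothGradient f₂ g₂) :
    HasSmoothGradient (fun x => f₁ x - f₂ x) (fun x => g₁ x - g₂ x) := by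
  simpa [sub_eq_add_neg] using h₁.add h₂.neg

lemma const (c : ℝ) : HasSmoothGradient (fun _ : Rd d => c) (fun _ => 0) :=
  ⟨contDiff_const, fun x => hasGradientAt_const x c⟩

lemma norm_sub_sq (c : Rd d) :
    HasSmoothGradient (fun x => ‖x - c‖ ^ 2) (fun x => (2 : ℝ) • (x - c)) := by
  refine ⟨(contDiff_id.sub contDiff_const).norm_sq ℝ, fun x => ?_⟩
  have := ((hasFDerivAt_id x).sub_const c).norm_sq
  rw [hasGradientAt_iff_hasFDerivAt]
  refine this.congr_fderiv ?_
  ext1 y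
  simp [InnerProductSpace.toDual_apply_apply]

lemma sqrt_norm_sub_sq (c : Rd d) {η : ℝ} (hη : 0 < η) :
    HasSmoothGradient (fun x => √(η ^ 2 + ‖x - c‖ ^ 2))
      (fun x => (√(η ^ 2 + ‖x - c‖ ^ 2))⁻¹ • (x - c)) := by
  have hpos : ∀ x : Rd d, η ^ 2 + ‖x - c‖ ^ 2 ≠ 0 := fun x => by positivity
  have h0 := (const (d := d) (η ^ 2)).add (norm_sub_sq c)
  refine ⟨h0.contDiff.sqrt hpos, fun x => ?_⟩
  have := (h0.hasGradientAt x).hasFDerivAt.sqrt (hpos x)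
  rw [hasGradientAt_iff_hasFDerivAt]
  refine this.congr_fderiv ?_
  ext1 y
  simp [InnerProductSpace.toDual_apply_apply]
  ring

/-- The gradient of a test function touching a `K`-Lipschitz function from above has norm at most
`K`. -/
lemma norm_le_of_touching {u : Rd d → ℝ} {K : ℝ} (hK : 0 ≤ K)
    (hu : ∀ x y, |u x - u y| ≤ K * ‖x - y‖) (h : HasSmoothGradient f g) {x : Rd d}
    (hx : IsLocalMax (fun z => u z - f z) x) : ‖g x‖ ≤ K := by
  by_contra! hlt
  have hgpos : 0 < ‖g x‖ := hK.trans_lt hlt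
  -- Along `x - τ • g x` the test function decreases at rate `‖g x‖ ^ 2`, while `u` decreases at
  -- rate at most `K * ‖g x‖`.
  have hcurve : HasDerivAt (fun τ : ℝ => x - τ • g x) (-g x) 0 := by
    simpa using ((hasDerivAt_id (0 : ℝ)).smul_const (g x)).const_sub x
  have hd : HasDerivAt (fun τ : ℝ => f (x - τ • g x)) (-(‖g x‖ ^ 2)) 0 := by
    have h1 : HasFDerivAt f (InnerProductSpace.toDual ℝ (Rd d) (g x)) (x - (0 : ℝ) • g x) := by
      simpa using (h.hasGradientAt x).hasFDerivAt
    have := h1.comp_hasDerivAt (0 : ℝ) hcurve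
    simpa [InnerProductSpace.toDual_apply_apply, Function.comp_def] using this
  have hslope := hasDerivAt_iff_tendsto_slope.1 hd
  have hslope' : Tendsto (slope (fun τ : ℝ => f (x - τ • g x)) 0) (𝓝[>] 0)
      (𝓝 (-(‖g x‖ ^ 2))) :=
    hslope.mono_left (nhdsWithin_mono _ fun t (ht : 0 < t) => ht.ne')
  have hev : ∀ᶠ τ : ℝ in 𝓝[>] 0, -(K * ‖g x‖) ≤ slope (fun τ : ℝ => f (x - τ • g x)) 0 τ := by
    have hc : Tendsto (fun τ : ℝ => x - τ • g x) (𝓝[>] 0) (𝓝 x) := by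
      have : ContinuousAt (fun τ : ℝ => x - τ • g x) 0 := hcurve.continuousAt
      have h2 := this.tendsto
      simp only [zero_smul, sub_zero] at h2
      exact h2.mono_left nhdsWithin_le_nhds
    filter_upwards [hc.eventually hx, self_mem_nhdsWithin] with τ h1 (hτ : 0 < τ)
    have h2 := (abs_le.1 (hu x (x - τ • g x))).2
    rw [sub_sub_cancel, norm_smul, Real.norm_of_nonneg hτ.le] at h2
    simp only [slope, vsub_eq_sub, sub_zero, smul_eq_mul, zero_smul]
    rw [le_inv_mul_iff₀ hτ]
    nlinarith
  have := ge_of_tendsto hslope' hev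
  nlinarith

end HasSmoothGradient

/-- A continuous function on a closed set whose superlevel set is bounded attains its maximum. -/
lemma exists_max_of_bounded_superlevel {X : Type*} [NormedAddCommGroup X] [ProperSpace X]
    {S : Set X} (hS : IsClosed S) {f : X → ℝ} (hf : ContinuousOn f S) {x₀ : X} (hx₀ : x₀ ∈ S)
    {R : ℝ} (h : ∀ x ∈ S, f x₀ ≤ f x → ‖x‖ ≤ R) : ∃ x ∈ S, ∀ y ∈ S, f y ≤ f x := by
  have hc : IsCompact (S ∩ closedBall 0 R) := (isCompact_closedBall 0 R).inter_left hS
  have hx₀' : x₀ ∈ S ∩ closedBall 0 R := ⟨hx₀, by simpa using h x₀ hx₀ le_rfl⟩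
  obtain ⟨x, hx, hmax⟩ := hc.exists_isMaxOn ⟨x₀, hx₀'⟩ (hf.mono inter_subset_left)
  refine ⟨x, hx.1, fun y hy => ?_⟩
  by_cases hle : f x₀ ≤ f y
  · exact hmax ⟨hy, by simpa using h y hy hle⟩
  · exact (not_le.1 hle).le.trans (hmax hx₀')

/-! ### The smoothed distance -/

/-- `√(η² + |x - c|²)`. -/
abbrev smoothDist (η : ℝ) (c x : Rd d) : ℝ := √(η ^ 2 + ‖x - c‖ ^ 2)

lemma norm_le_smoothDist (η : ℝ) (c x : Rd d) : ‖x - c‖ ≤ smoothDist η c x :=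
  Real.le_sqrt_of_sq_le (by nlinarith [sq_nonneg η])

lemma smoothDist_le (η : ℝ) (c x y : Rd d) :
    smoothDist η c x ≤ smoothDist η c y + ‖x - y‖ := by
  have h1 : ‖x - c‖ ≤ ‖x - y‖ + ‖y - c‖ := norm_sub_le_norm_sub_add_norm_sub x y c
  have h2 := norm_le_smoothDist η c y
  have h3 : smoothDist η c y ^ 2 = η ^ 2 + ‖y - c‖ ^ 2 := Real.sq_sqrt (by positivity)
  refine (Real.sqrt_le_left (by positivity)).2 ?_
  nlinarith [norm_nonneg (x - y), norm_nonneg (y - c), norm_nonneg (x - c),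
    mul_nonneg (norm_nonneg (x - y)) (sub_nonneg.2 h2)]

lemma norm_smoothDist_gradient_le (η : ℝ) (c x : Rd d) :
    ‖(smoothDist η c x)⁻¹ • (x - c)‖ ≤ 1 := by
  have h0 : 0 ≤ smoothDist η c x := Real.sqrt_nonneg _
  rw [norm_smul, norm_inv, Real.norm_of_nonneg h0]
  exact inv_mul_le_one_of_le₀ (norm_le_smoothDist η c x) h0

lemma continuous_smoothDist (η : ℝ) (c : Rd d) : Continuous (smoothDist η c) := by
  unfold smoothDist; fun_prop

/-! ### Stationary viscosity sub- and supersolutions -/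

/-- `v` is a viscosity subsolution of `δ v + F(Dv, y) = 0`. -/
def IsCellSub (F : Rd d → Rd d → ℝ) (δ : ℝ) (v : Rd d → ℝ) : Prop :=
  ∀ φ : Rd d → ℝ, ContDiff ℝ 1 φ → ∀ y : Rd d,
    IsLocalMax (fun z => v z - φ z) y → δ * v y + F (gradient φ y) y ≤ 0

/-- `v` is a viscosity supersolution of `δ v + F(Dv, y) = 0`. -/
def IsCellSuper (F : Rd d → Rd d → ℝ) (δ : ℝ) (v : Rd d → ℝ) : Prop :=
  ∀ φ : Rd d → ℝ, ContDiff ℝ 1 φ → ∀ y : Rd d,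
    IsLocalMin (fun z => v z - φ z) y → 0 ≤ δ * v y + F (gradient φ y) y

section

variable {F : Rd d → Rd d → ℝ} {δ : ℝ} {u v w f : Rd d → ℝ} {g : Rd d → Rd d}

lemma IsCellSub.test (h : IsCellSub F δ v) (hf : HasSmoothGradient f g) {y : Rd d}
    (hy : IsLocalMax (fun z => v z - f z) y) : δ * v y + F (g y) y ≤ 0 := by
  simpa [hf.gradient_eq] using h f hf.contDiff y hy

lemma IsCellSuper.test (h : IsCellSuper F δ v) (hf : HasSmoothGradient f g) {y : Rd d}
    (hy : IsLocalMin (fun z => v z - f z) y) : 0 ≤ δ * v y + F (g y) y := by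
  simpa [hf.gradient_eq] using h f hf.contDiff y hy

/-- Bounded continuous functions all of whose superdifferentials are bounded by `Λ` are
`2Λ`-Lipschitz. -/
lemma lipschitz_of_touching_bound {Λ : ℝ} (hΛ : 0 < Λ) (hc : Continuous v)
    (hb : ∃ M, ∀ y, |v y| ≤ M)
    (h : ∀ φ : Rd d → ℝ, ContDiff ℝ 1 φ → ∀ y : Rd d,
      IsLocalMax (fun z => v z - φ z) y → ‖gradient φ y‖ ≤ Λ) (x y : Rd d) :
    |v x - v y| ≤ 2 * Λ * ‖x - y‖ := by
  obtain ⟨M, hM⟩ := hb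
  have key : ∀ x₀ x : Rd d, v x - 2 * Λ * ‖x - x₀‖ ≤ v x₀ := by
    intro x₀ x
    -- A smoothed cone of slope `2Λ` has gradient of norm at most `Λ` only within distance `η` of
    -- its vertex, so the maximum point tends to `x₀` as `η → 0`.
    have hη : ∀ η : ℝ, 0 < η → ∃ z, ‖z - x₀‖ ≤ η ∧ v x - 2 * Λ * smoothDist η x₀ x ≤ v z := by
      intro η hη
      have hg := (HasSmoothGradient.sqrt_norm_sub_sq x₀ hη).const_mul (2 * Λ)
      obtain ⟨z, -, hz⟩ := exists_max_of_bounded_superlevel (S := univ) isClosed_univ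
        (f := fun z => v z - 2 * Λ * smoothDist η x₀ z)
        ((hc.sub (continuous_const.mul (continuous_smoothDist η x₀))).continuousOn) (mem_univ x₀)
        (R := ‖x₀‖ + (2 * M + 2 * Λ * η) / (2 * Λ)) (by
          intro z _ hz
          have h1 : smoothDist η x₀ x₀ = η := by simp [smoothDist, Real.sqrt_sq hη.le]
          simp only [h1] at hz
          have h2 := norm_le_smoothDist η x₀ z
          have h3 := (abs_le.1 (hM z)).2
          have h4 := (abs_le.1 (hM x₀)).1
          have h5 : ‖z - x₀‖ ≤ (2 * M + 2 * Λ * η) / (2 * Λ) := by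
            rw [le_div_iff₀ (by positivity)]
            nlinarith
          have h6 : ‖z‖ ≤ ‖x₀‖ + ‖z - x₀‖ := by
            simpa using norm_add_le x₀ (z - x₀)
          linarith)
      refine ⟨z, ?_, ?_⟩
      · have h1 := h _ hg.contDiff z (Eventually.of_forall fun y => hz y (mem_univ y))
        rw [hg.gradient_eq] at h1
        have hs : 0 < smoothDist η x₀ z := Real.sqrt_pos.2 (by positivity)
        have h2 : smoothDist η x₀ z ^ 2 = η ^ 2 + ‖z - x₀‖ ^ 2 := Real.sq_sqrt (by positivity)
        rw [norm_smul, norm_smul, Real.norm_of_nonneg (by positivity), norm_inv,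
          Real.norm_of_nonneg hs.le] at h1
        have h3 : 2 * ‖z - x₀‖ ≤ smoothDist η x₀ z := by
          have h4 : 2 * ((smoothDist η x₀ z)⁻¹ * ‖z - x₀‖) ≤ 1 := by
            by_contra! hcon
            nlinarith
          have h5 : (smoothDist η x₀ z)⁻¹ * (2 * ‖z - x₀‖) ≤ 1 := by linarith
          rw [inv_mul_le_iff₀ hs] at h5
          linarith
        nlinarith [norm_nonneg (z - x₀)]
      · have h1 := hz x (mem_univ x)
        have h2 : 0 ≤ 2 * Λ * smoothDist η x₀ z := by positivity
        linarith
    refine le_of_forall_pos_lt_add fun e he => ?_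
    obtain ⟨r, hr, hr'⟩ := Metric.continuous_iff.1 hc x₀ (e / 2) (by positivity)
    set η := min (r / 2) (e / (8 * Λ)) with hηdef
    have hηpos : 0 < η := by positivity
    obtain ⟨z, hz1, hz2⟩ := hη η hηpos
    have h1 := hr' z (by
      rw [dist_eq_norm]
      have := min_le_left (r / 2) (e / (8 * Λ))
      linarith)
    rw [Real.dist_eq] at h1
    have h2 : smoothDist η x₀ x ≤ η + ‖x - x₀‖ := by
      have := smoothDist_le η x₀ x x₀
      simpa [smoothDist, Real.sqrt_sq hηpos.le] using this
    have h3 : η * (8 * Λ) ≤ e := by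
      rw [← le_div_iff₀ (by positivity)]
      exact min_le_right _ _
    have := (abs_lt.1 h1).2
    nlinarith
  have h1 := key y x
  have h2 := key x y
  rw [norm_sub_rev] at h2
  rw [abs_le]
  constructor <;> linarith

/-- Comparison principle: bounded Lipschitz subsolutions lie below bounded continuous
supersolutions. -/
theorem IsCellSub.le_of_isCellSuper (hδ : 0 < δ) (hu : IsCellSub F δ u) (hw : IsCellSuper F δ w)
    (hub : ∃ M, ∀ y, |u y| ≤ M) (hwb : ∃ M, ∀ y, |w y| ≤ M)
    {k : ℝ} (hk : 0 ≤ k) (huL : ∀ x y, |u x - u y| ≤ k * ‖x - y‖) (hwc : Continuous w)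
    (hF : ∀ R : ℝ, 0 < R →
      UniformContinuousOn (fun q : Rd d × Rd d => F q.1 q.2) (ball 0 R ×ˢ univ))
    (y₀ : Rd d) : u y₀ ≤ w y₀ := by
  have huc : Continuous u := by
    refine (LipschitzWith.of_dist_le_mul (K := k.toNNReal) fun x y => ?_).continuous
    rw [Real.dist_eq, dist_eq_norm, Real.coe_toNNReal _ hk]
    exact huL x y
  obtain ⟨M₁, hM₁⟩ := hub
  obtain ⟨M₂, hM₂⟩ := hwb
  suffices h : ∀ ω : ℝ, 0 < ω → δ * (u y₀ - w y₀) ≤ 2 * ω by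
    by_contra! hlt
    have h1 : 0 < δ * (u y₀ - w y₀) := mul_pos hδ (by linarith)
    have := h (δ * (u y₀ - w y₀) / 4) (by positivity)
    linarith
  intro ω hω
  obtain ⟨θ, hθ, hmod⟩ := Metric.uniformContinuousOn_iff.1 (hF (2 * k + 4) (by linarith)) ω hω
  set J : Rd d → ℝ := smoothDist 1 0 with hJ
  have hJ0 : ∀ x, 0 < J x := fun x => Real.sqrt_pos.2 (by positivity)
  set β : ℝ := min (min 1 (θ / 2)) (ω / (δ * J y₀)) with hβ
  have hβ0 : 0 < β := by have := hJ0 y₀; positivity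
  have hβ1 : β ≤ 1 := (min_le_left _ _).trans (min_le_left _ _)
  have hβθ : β ≤ θ / 2 := (min_le_left _ _).trans (min_le_right _ _)
  have hβω : β * (δ * J y₀) ≤ ω := by
    have := hJ0 y₀
    rw [← le_div_iff₀ (by positivity)]
    exact min_le_right _ _
  set e : ℝ := θ / (4 * (k + 1)) with he
  have he0 : 0 < e := by positivity
  have heθ : 4 * (k + 1) * e = θ := by rw [he]; field_simp
  set Φ : Rd d × Rd d → ℝ :=
    fun q => u q.1 - w q.2 - (2 * e)⁻¹ * ‖q.1 - q.2‖ ^ 2 - β * J q.1 with hΦ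
  have hΦc : Continuous Φ := by
    have := continuous_smoothDist (d := d) 1 0
    fun_prop
  obtain ⟨⟨x, y⟩, -, hmax⟩ := exists_max_of_bounded_superlevel isClosed_univ hΦc.continuousOn
    (mem_univ (0 : Rd d × Rd d))
    (R := (M₁ + M₂ - Φ 0) / β + (1 + 2 * e * (M₁ + M₂ - Φ 0))) (by
      rintro ⟨x, y⟩ - hle
      have h1 : (2 * e)⁻¹ * ‖x - y‖ ^ 2 + β * J x ≤ M₁ + M₂ - Φ 0 := by
        have h2 := (abs_le.1 (hM₁ x)).2
        have h3 := (abs_le.1 (hM₂ y)).1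
        have h4 : Φ 0 ≤ u x - w y - (2 * e)⁻¹ * ‖x - y‖ ^ 2 - β * J x := hle
        linarith
      have h2 : 0 ≤ (2 * e)⁻¹ * ‖x - y‖ ^ 2 := by positivity
      have h3 : 0 < β * J x := mul_pos hβ0 (hJ0 x)
      have h4 : ‖x‖ ≤ (M₁ + M₂ - Φ 0) / β := by
        rw [le_div_iff₀ hβ0]
        have := norm_le_smoothDist 1 0 x
        rw [sub_zero] at this
        nlinarith
      have h5 : ‖x - y‖ ≤ 1 + 2 * e * (M₁ + M₂ - Φ 0) := by
        have h6 : (2 * e)⁻¹ * ‖x - y‖ ^ 2 ≤ M₁ + M₂ - Φ 0 := by linarith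
        rw [inv_mul_le_iff₀ (by positivity)] at h6
        nlinarith [norm_nonneg (x - y)]
      have h6 : ‖y‖ ≤ ‖x‖ + ‖x - y‖ := by
        have := norm_sub_le x (x - y)
        simpa using this
      have h7 : 0 ≤ 1 + 2 * e * (M₁ + M₂ - Φ 0) := (norm_nonneg _).trans h5
      rw [Prod.norm_def]
      refine max_le ?_ ?_ <;> simp only <;> linarith)
  have hΦ' : ∀ x' y', Φ (x', y') ≤ Φ (x, y) := fun x' y' => hmax (x', y') (mem_univ _)
  simp only [hΦ] at hΦ'
  set q : Rd d := e⁻¹ • (x - y) with hq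
  set n : Rd d := (J x)⁻¹ • x with hn
  have hn1 : ‖n‖ ≤ 1 := by simpa using norm_smoothDist_gradient_le 1 0 x
  -- Comparing the maximum with its value at `(y, y)` and using the Lipschitz bound on `u` alone
  -- bounds the slope `q` independently of `e`.
  have hxy : ‖x - y‖ ≤ 2 * e * (k + 1) := by
    have h1 := hΦ' y y
    have h2 := (abs_le.1 (huL x y)).2
    have h3 := smoothDist_le 1 0 y x
    rw [norm_sub_rev] at h3
    simp only [sub_self, norm_zero] at h1
    have h4 : (2 * e)⁻¹ * ‖x - y‖ ^ 2 ≤ (k + 1) * ‖x - y‖ := by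
      have h5 : β * J y ≤ β * J x + β * ‖x - y‖ := by nlinarith
      have h6 : β * ‖x - y‖ ≤ 1 * ‖x - y‖ := mul_le_mul_of_nonneg_right hβ1 (norm_nonneg _)
      linarith
    rw [inv_mul_le_iff₀ (by positivity)] at h4
    by_contra! hlt
    have h7 : 0 < ‖x - y‖ := lt_of_le_of_lt (by positivity) hlt
    nlinarith
  have hqn : ‖q‖ ≤ 2 * (k + 1) := by
    rw [hq, norm_smul, norm_inv, Real.norm_of_nonneg he0.le, inv_mul_le_iff₀ he0]
    linarith
  have hsub : δ * u x + F (q + β • n) x ≤ 0 := by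
    have hf := (((HasSmoothGradient.norm_sub_sq y).const_mul (2 * e)⁻¹).add
      ((HasSmoothGradient.sqrt_norm_sub_sq (0 : Rd d) one_pos).const_mul β))
    have := hu.test hf (y := x) (Eventually.of_forall fun z => by
      have := hΦ' z y
      simp only [hJ, smoothDist] at this
      simp only
      linarith)
    convert this using 3
    rw [hq, hn, smul_smul (2 * e)⁻¹]
    simp only [hJ, smoothDist, sub_zero]
    congr 2
    field_simp
  have hsup : 0 ≤ δ * w y + F q y := by
    have hf := ((HasSmoothGradient.norm_sub_sq x).const_mul (-(2 * e)⁻¹))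
    have := hw.test hf (y := y) (Eventually.of_forall fun z => by
      have := hΦ' x z
      simp only
      rw [norm_sub_rev z x, norm_sub_rev y x]
      linarith)
    convert this using 3
    rw [smul_smul, hq, ← neg_sub y x, smul_neg, ← neg_smul]
    congr 1
    field_simp
  have hβn : ‖β • n‖ ≤ β := by
    rw [norm_smul, Real.norm_of_nonneg hβ0.le]
    nlinarith
  have hclose := hmod (q, y) ⟨by rw [mem_ball_zero_iff]; linarith, mem_univ _⟩
    (q + β • n, x) ⟨by
      rw [mem_ball_zero_iff]
      have := norm_add_le q (β • n)
      linarith, mem_univ _⟩ (by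
      rw [Prod.dist_eq]
      refine max_lt ?_ ?_
      · simp only [dist_self_add_right]
        linarith
      · simp only
        rw [dist_comm, dist_eq_norm]
        nlinarith)
  rw [Real.dist_eq] at hclose
  have h1 := (abs_lt.1 hclose).2
  have h2 := hΦ' y₀ y₀
  simp only [sub_self, norm_zero] at h2
  have h3 : 0 ≤ (2 * e)⁻¹ * ‖x - y‖ ^ 2 := by positivity
  have h4 : 0 < β * J x := mul_pos hβ0 (hJ0 x)
  have h5 : u y₀ - w y₀ ≤ u x - w y + β * J y₀ := by linarith
  have h6 := mul_le_mul_of_nonneg_left h5 hδ.le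
  nlinarith

end

/-! ### Operations on stationary sub- and supersolutions, and Perron's method. -/

section

variable {F G : Rd d → Rd d → ℝ} {δ γ : ℝ} {u v w f : Rd d → ℝ} {g : Rd d → Rd d}

lemma HasSmoothGradient.eq_zero_of_isLocalMax (h : HasSmoothGradient f g) {x : Rd d}
    (hx : IsLocalMax f x) : g x = 0 := by
  have h1 := h.neg.norm_le_of_touching (u := fun _ => 0) (K := 0) le_rfl (by simp) (x := x)
    (by simpa using hx)
  simpa using h1

lemma isCellSub_const {c : ℝ} (h : ∀ y, δ * c + F 0 y ≤ 0) : IsCellSub F δ (fun _ => c) := by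
  intro φ hφ y hy
  have h1 := ((HasSmoothGradient.const c).sub
    (HasSmoothGradient.of_contDiff hφ)).eq_zero_of_isLocalMax hy
  have h2 : gradient φ y = 0 := by simpa using h1
  rw [h2]
  exact h y

lemma isCellSuper_const {c : ℝ} (h : ∀ y, 0 ≤ δ * c + F 0 y) :
    IsCellSuper F δ (fun _ => c) := by
  intro φ hφ y hy
  have h1 := ((HasSmoothGradient.const c).sub
    (HasSmoothGradient.of_contDiff hφ)).neg.eq_zero_of_isLocalMax hy.neg
  have h2 : gradient φ y = 0 := by simpa using h1
  rw [h2]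
  exact h y

/-- A constant shift leaves the gradients of test functions unchanged, so a pointwise implication
suffices to change both the discount and the Hamiltonian. -/
lemma IsCellSub.transfer (h : IsCellSub F δ v) (c : ℝ)
    (hc : ∀ y q, δ * v y + F q y ≤ 0 → γ * (v y - c) + G q y ≤ 0) :
    IsCellSub G γ (fun y => v y - c) := fun φ hφ y hy =>
  hc y _ (h φ hφ y (by
    filter_upwards [hy] with z hz
    linarith))

lemma IsCellSuper.transfer (h : IsCellSuper F δ v) (c : ℝ)
    (hc : ∀ y q, 0 ≤ δ * v y + F q y → 0 ≤ γ * (v y + c) + G q y) :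
    IsCellSuper G γ (fun y => v y + c) := fun φ hφ y hy =>
  hc y _ (h φ hφ y (by
    filter_upwards [hy] with z hz
    linarith))

lemma HasSmoothGradient.comp_sub (h : HasSmoothGradient f g) (a : Rd d) :
    HasSmoothGradient (fun x => f (x - a)) (fun x => g (x - a)) := by
  refine ⟨h.contDiff.comp (contDiff_id.sub contDiff_const), fun x => ?_⟩
  have h1 : HasFDerivAt (fun x : Rd d => x - a) (ContinuousLinearMap.id ℝ (Rd d)) x :=
    (hasFDerivAt_id x).sub_const a
  have := (h.hasGradientAt (x - a)).hasFDerivAt.comp x h1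
  rwa [ContinuousLinearMap.comp_id, ← hasGradientAt_iff_hasFDerivAt] at this

lemma IsCellSub.translate (h : IsCellSub F δ v) (a : Rd d) :
    IsCellSub (fun q y => F q (y + a)) δ (fun y => v (y + a)) := by
  intro φ hφ y hy
  have h1 := h.test ((HasSmoothGradient.of_contDiff hφ).comp_sub a) (y := y + a) (by
    have hc : Tendsto (fun z : Rd d => z - a) (𝓝 (y + a)) (𝓝 y) := by
      have : ContinuousAt (fun z : Rd d => z - a) (y + a) := by fun_prop
      simpa using this.tendsto
    filter_upwards [hc.eventually hy] with z hz
    simpa using hz)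
  simpa using h1

/-- Bounded subsolutions of a coercive equation are Lipschitz. -/
lemma IsCellSub.exists_lipschitz (hδ : 0 < δ) (hF : IsCoercive F) (h : IsCellSub F δ v)
    (hc : Continuous v) (hb : ∃ M, ∀ y, |v y| ≤ M) :
    ∃ k : ℝ, 0 ≤ k ∧ ∀ x y, |v x - v y| ≤ k * ‖x - y‖ := by
  obtain ⟨M, hM⟩ := hb
  obtain ⟨R, hR⟩ := hF (δ * M + 1)
  refine ⟨2 * max R 1, by positivity, lipschitz_of_touching_bound (by positivity) hc ⟨M, hM⟩ ?_⟩
  intro φ hφ y hy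
  by_contra! hlt
  have h1 := h φ hφ y hy
  have h2 := hR _ ((le_max_left _ _).trans hlt.le) y
  have h3 := mul_le_mul_of_nonneg_left (abs_le.1 (hM y)).1 hδ.le
  linarith

/-- Perron's method for coercive equations. -/
theorem exists_bounded_lipschitz_solution (hδ : 0 < δ)
    (hFc : Continuous fun q : Rd d × Rd d => F q.1 q.2) {M₀ : ℝ} (hM₀ : ∀ y, |F 0 y| ≤ M₀)
    (hF : IsCoercive F) :
    ∃ v : Rd d → ℝ, (∀ y, |v y| ≤ M₀ / δ) ∧
      (∃ k : ℝ, 0 ≤ k ∧ ∀ x y, |v x - v y| ≤ k * ‖x - y‖) ∧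
      IsCellSub F δ v ∧ IsCellSuper F δ v := by
  obtain ⟨Λ₀, hΛ₀⟩ := hF (M₀ + 1)
  set Λ := max Λ₀ 1 with hΛdef
  have hΛ : 0 < Λ := by positivity
  have hM₀0 : 0 ≤ M₀ := (abs_nonneg _).trans (hM₀ 0)
  have hδM : δ * (M₀ / δ) = M₀ := by field_simp
  set S : Set (Rd d → ℝ) := {w | Continuous w ∧ (∀ y, |w y| ≤ M₀ / δ) ∧ IsCellSub F δ w} with hS
  -- Coercivity makes the whole Perron class equi-Lipschitz, so its supremum is continuous and no
  -- semicontinuous envelopes are needed.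
  have hSlip : ∀ w ∈ S, ∀ x y, |w x - w y| ≤ 2 * Λ * ‖x - y‖ := by
    rintro w ⟨hwc, hwb, hws⟩
    refine lipschitz_of_touching_bound hΛ hwc ⟨_, hwb⟩ fun φ hφ y hy => ?_
    by_contra! hlt
    have h1 := hws φ hφ y hy
    have h2 := hΛ₀ _ ((le_max_left _ _).trans hlt.le) y
    have h3 := mul_le_mul_of_nonneg_left (abs_le.1 (hwb y)).1 hδ.le
    rw [mul_neg, hδM] at h3
    linarith
  have hconst : (fun _ => -(M₀ / δ)) ∈ S := by
    refine ⟨continuous_const, fun y => ?_, isCellSub_const fun y => ?_⟩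
    · rw [abs_neg, abs_of_nonneg (by positivity)]
    · rw [mul_neg, hδM]
      have := (abs_le.1 (hM₀ y)).2
      linarith
  have : Nonempty S := ⟨⟨_, hconst⟩⟩
  set v : Rd d → ℝ := fun y => ⨆ w : S, w.1 y with hv
  have hbdd : ∀ y, BddAbove (range fun w : S => w.1 y) := fun y =>
    ⟨M₀ / δ, by rintro _ ⟨w, rfl⟩; exact (abs_le.1 (w.2.2.1 y)).2⟩
  have hle : ∀ w ∈ S, ∀ y, w y ≤ v y := fun w hw y => le_ciSup (hbdd y) ⟨w, hw⟩
  have hvle : ∀ y, v y ≤ M₀ / δ := fun y => ciSup_le fun w => (abs_le.1 (w.2.2.1 y)).2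
  have hvb : ∀ y, |v y| ≤ M₀ / δ := fun y => abs_le.2 ⟨hle _ hconst y, hvle y⟩
  have hv1 : ∀ x y, v x ≤ v y + 2 * Λ * ‖x - y‖ := fun x y => ciSup_le fun w => by
    have h1 := (abs_le.1 (hSlip w.1 w.2 x y)).2
    have h2 := hle w.1 w.2 y
    linarith
  have hvlip : ∀ x y, |v x - v y| ≤ 2 * Λ * ‖x - y‖ := fun x y => by
    have h1 := hv1 x y
    have h2 := hv1 y x
    rw [norm_sub_rev] at h2
    rw [abs_le]
    constructor <;> linarith
  have hvc : Continuous v := by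
    refine (LipschitzWith.of_dist_le_mul (K := (2 * Λ).toNNReal) fun x y => ?_).continuous
    rw [Real.dist_eq, dist_eq_norm, Real.coe_toNNReal _ (by positivity)]
    exact hvlip x y
  have hvsub : IsCellSub F δ v := by
    intro φ hφ y hy
    by_contra! hpos
    have hg := HasSmoothGradient.of_contDiff hφ
    set c := δ * v y + F (gradient φ y) y with hc
    have hcont : Continuous fun z => δ * v y + F (gradient φ z + (2 : ℝ) • (z - y)) z := by
      have h1 := hg.continuous
      have h2 : Continuous fun z => (gradient φ z + (2 : ℝ) • (z - y), z) := by fun_prop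
      exact continuous_const.add (hFc.comp h2)
    have hev : ∀ᶠ z in 𝓝 y, c / 2 < δ * v y + F (gradient φ z + (2 : ℝ) • (z - y)) z := by
      refine (hcont.tendsto y).eventually_const_lt ?_
      simp only [sub_self, smul_zero, add_zero]
      linarith
    obtain ⟨r, hr, hball⟩ := Metric.eventually_nhds_iff_ball.1 (hev.and hy)
    set τ := min (r / 2) (min 1 (c / (4 * δ * (1 + 2 * Λ)))) with hτ
    have hτ0 : 0 < τ := by positivity
    have hτr : τ ≤ r / 2 := min_le_left _ _
    have hτ1 : τ ≤ 1 := (min_le_right _ _).trans (min_le_left _ _)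
    have hτc : τ * (4 * δ * (1 + 2 * Λ)) ≤ c := by
      rw [← le_div_iff₀ (by positivity)]
      exact (min_le_right _ _).trans (min_le_right _ _)
    -- A member `w` within `τ ^ 2` of `v` at `y` is tested with `φ + ‖· - y‖ ^ 2`; the quadratic
    -- term confines its maximum to distance `τ` from `y`.
    obtain ⟨⟨w, hwS⟩, hw⟩ := exists_lt_of_lt_ciSup
      (show v y - τ ^ 2 < ⨆ w : S, w.1 y from sub_lt_self _ (by positivity))
    simp only at hw
    obtain ⟨z, hz, hmax⟩ := (isCompact_closedBall y (r / 2)).exists_isMaxOn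
      ⟨y, mem_closedBall_self (by positivity)⟩
      (f := fun z => w z - (φ z + ‖z - y‖ ^ 2)) (by
        have := hwS.1
        have := hφ.continuous
        fun_prop)
    have hzr : dist z y ≤ r / 2 := hz
    have hmy := hmax (mem_closedBall_self (x := y) (by positivity))
    simp only [mem_ofPred_eq, sub_self, norm_zero] at hmy
    have hvz := (hball z (by rw [mem_ball]; linarith)).2
    simp only at hvz
    have hzτ : ‖z - y‖ < τ := by
      have := hle w hwS z
      have h1 : ‖z - y‖ ^ 2 < τ ^ 2 := by linarith
      exact lt_of_pow_lt_pow_left₀ 2 hτ0.le h1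
    have hloc : IsLocalMax (fun z => w z - (φ z + ‖z - y‖ ^ 2)) z := by
      refine hmax.isLocalMax (closedBall_mem_nhds_of_mem ?_)
      rw [mem_ball, dist_eq_norm]
      linarith
    have h1 := hwS.2.2.test (hg.add (HasSmoothGradient.norm_sub_sq y)) hloc
    have h2 := (hball z (by rw [mem_ball]; linarith)).1
    have h3 := (abs_le.1 (hSlip w hwS z y)).1
    have h4 : v y - τ ^ 2 - 2 * Λ * τ ≤ w z := by nlinarith
    have h5 := mul_le_mul_of_nonneg_left h4 hδ.le
    have h6 : τ ^ 2 ≤ τ := by nlinarith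
    nlinarith
  refine ⟨v, hvb, ⟨2 * Λ, by positivity, hvlip⟩, hvsub, ?_⟩
  · intro φ hφ y hy
    by_contra! hneg
    have hg := HasSmoothGradient.of_contDiff hφ
    -- Where `v` attains the upper bound, `φ` has a local maximum, so its gradient vanishes and the
    -- supersolution inequality holds. Otherwise there is room to push `v` up.
    have hvy : v y < M₀ / δ := by
      refine lt_of_le_of_ne (hvle y) fun heq => ?_
      have h1 := hg.eq_zero_of_isLocalMax (x := y) (by
        filter_upwards [hy] with z hz
        have := hvle z
        linarith)
      rw [h1, heq, hδM] at hneg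
      have := (abs_le.1 (hM₀ y)).1
      linarith
    have hφc := hφ.continuous
    have hev1 : ∀ᶠ q : Rd d × ℝ in 𝓝 (y, 0), δ * (v y + (φ q.1 - φ y) + q.2) +
        F (gradient φ q.1 - (2 : ℝ) • (q.1 - y)) q.1 < 0 := by
      have h1 := hg.continuous
      have h2 : Continuous fun q : Rd d × ℝ =>
          (gradient φ q.1 - (2 : ℝ) • (q.1 - y), q.1) := by fun_prop
      have h3 : Continuous fun q : Rd d × ℝ => δ * (v y + (φ q.1 - φ y) + q.2) +
          F (gradient φ q.1 - (2 : ℝ) • (q.1 - y)) q.1 := by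
        refine Continuous.add (by fun_prop) (hFc.comp h2)
      refine (h3.tendsto (y, 0)).eventually_lt_const ?_
      simpa using hneg
    have hev2 : ∀ᶠ q : Rd d × ℝ in 𝓝 (y, 0), v y + (φ q.1 - φ y) + q.2 < M₀ / δ := by
      have h3 : Continuous fun q : Rd d × ℝ => v y + (φ q.1 - φ y) + q.2 := by fun_prop
      refine (h3.tendsto (y, 0)).eventually_lt_const ?_
      simpa using hvy
    obtain ⟨r₁, hr₁, hball₁⟩ := Metric.eventually_nhds_iff_ball.1 (hev1.and hev2)
    obtain ⟨r₂, hr₂, hball₂⟩ := Metric.eventually_nhds_iff_ball.1 hy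
    set r := min (min (r₁ / 2) 1) (r₂ / 2) with hr
    have hr0 : 0 < r := by positivity
    have hrr₁ : r ≤ r₁ / 2 := (min_le_left _ _).trans (min_le_left _ _)
    have hr1 : r ≤ 1 := (min_le_left _ _).trans (min_le_right _ _)
    have hrr₂ : r ≤ r₂ / 2 := min_le_right _ _
    -- The bump exceeds `v` by `r ^ 2 / 2` at `y` but lies below `v` on the sphere of radius `r`, so
    -- it can be glued to `v` into a larger member of `S`.
    set ψ : Rd d → ℝ := fun z => φ z - ‖z - y‖ ^ 2 + (v y - φ y + r ^ 2 / 2) with hψ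
    have hψg : HasSmoothGradient ψ (fun z => gradient φ z - (2 : ℝ) • (z - y)) := by
      simpa using (hg.sub (HasSmoothGradient.norm_sub_sq y)).add
        (HasSmoothGradient.const (v y - φ y + r ^ 2 / 2))
    have hψprop : ∀ z, ‖z - y‖ ≤ r →
        δ * ψ z + F (gradient φ z - (2 : ℝ) • (z - y)) z < 0 ∧ ψ z ≤ M₀ / δ := by
      intro z hz
      obtain ⟨h1, h2⟩ := hball₁ (z, r ^ 2 / 2) (by
        rw [mem_ball, Prod.dist_eq]
        refine max_lt ?_ ?_
        · simp only [dist_eq_norm]; linarith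
        · simp only [Real.dist_eq, sub_zero]
          rw [abs_of_nonneg (by positivity)]
          nlinarith)
      simp only at h1 h2
      have h3 : ψ z ≤ v y + (φ z - φ y) + r ^ 2 / 2 := by
        simp only [hψ]
        nlinarith [sq_nonneg ‖z - y‖]
      exact ⟨by nlinarith, by linarith⟩
    have hψv : ∀ z, ‖z - y‖ = r → ψ z ≤ v z := by
      intro z hz
      have h1 := hball₂ z (by rw [mem_ball, dist_eq_norm]; linarith)
      simp only at h1
      simp only [hψ, hz]
      nlinarith
    set w : Rd d → ℝ := fun z => if ‖z - y‖ ≤ r then max (v z) (ψ z) else v z with hw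
    have hwc : Continuous w := by
      refine Continuous.if_le (hvc.max hψg.contDiff.continuous) hvc (by fun_prop)
        continuous_const fun z hz => max_eq_left (hψv z hz)
    have hvw : ∀ z, v z ≤ w z := by
      intro z
      simp only [hw]
      split_ifs
      · exact le_max_left _ _
      · exact le_rfl
    have hwle : ∀ z, w z ≤ M₀ / δ := by
      intro z
      simp only [hw]
      split_ifs with h
      · exact max_le (hvle z) (hψprop z h).2
      · exact hvle z
    have hwS : w ∈ S := by
      refine ⟨hwc, fun z => abs_le.2 ⟨(abs_le.1 (hvb z)).1.trans (hvw z), hwle z⟩, ?_⟩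
      intro χ hχ z hz
      by_cases hwv : w z = v z
      · rw [hwv]
        refine hvsub χ hχ z ?_
        filter_upwards [hz] with x hx
        have := hvw x
        linarith
      · have hzr : ‖z - y‖ ≤ r := by
          by_contra hcon
          exact hwv (by simp only [hw, if_neg hcon])
        have hwz : w z = ψ z := by
          have h1 : w z = max (v z) (ψ z) := by simp only [hw, if_pos hzr]
          rcases max_choice (v z) (ψ z) with h2 | h2
          · exact absurd (h1.trans h2) hwv
          · exact h1.trans h2
        have hzr' : ‖z - y‖ < r := by
          refine lt_of_le_of_ne hzr fun heq => hwv ?_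
          have h1 := hψv z heq
          exact le_antisymm (hwz ▸ h1) (hvw z)
        have hnear : ∀ᶠ x in 𝓝 z, ‖x - y‖ < r :=
          (by fun_prop : Continuous fun x : Rd d => ‖x - y‖).continuousAt.eventually_lt_const hzr'
        have h1 := (hψg.sub (HasSmoothGradient.of_contDiff hχ)).eq_zero_of_isLocalMax (x := z) (by
          filter_upwards [hz, hnear] with x hx hxr
          have h2 : w x = max (v x) (ψ x) := by simp only [hw, if_pos hxr.le]
          have h3 := le_max_right (v x) (ψ x)
          linarith)
        rw [hwz, ← sub_eq_zero.1 h1]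
        exact (hψprop z hzr).1.le
    have h1 := hle w hwS y
    have h2 : w y = max (v y) (ψ y) := by simp [hw, hr0.le]
    have h3 := le_max_right (v y) (ψ y)
    have h4 : ψ y = v y + r ^ 2 / 2 := by simp [hψ]; ring
    nlinarith [sq_pos_of_pos hr0]

end

/-! ### The approximate cell problem -/

/-- The Hamiltonian `(q, y) ↦ H(p + q, y)` of the cell problem at slope `p`. -/
abbrev cellHam (H : Rd d → Rd d → ℝ) (p : Rd d) : Rd d → Rd d → ℝ := fun q y => H (p + q) y

section

variable {H : Rd d → Rd d → ℝ} {δ γ δ' : ℝ} {p q : Rd d} {v w : Rd d → ℝ}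

lemma IsCoercive.cellHam (h : IsCoercive H) (p : Rd d) : IsCoercive (cellHam H p) := by
  intro M
  obtain ⟨R, hR⟩ := h M
  refine ⟨R + ‖p‖, fun q hq y => hR _ ?_ y⟩
  have := norm_sub_le (p + q) p
  rw [add_sub_cancel_left] at this
  linarith

lemma IsRegular.uniformContinuousOn_cellHam (h : IsRegular H) (p : Rd d) {R : ℝ} (hR : 0 < R) :
    UniformContinuousOn (fun q : Rd d × Rd d => cellHam H p q.1 q.2) (ball 0 R ×ˢ univ) := by
  have h1 := (h (R + ‖p‖) (by positivity)).1
  rw [Metric.uniformContinuousOn_iff] at h1 ⊢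
  intro ε hε
  obtain ⟨θ, hθ, h2⟩ := h1 ε hε
  have hmem : ∀ a ∈ (ball 0 R ×ˢ univ : Set (Rd d × Rd d)),
      (p + a.1, a.2) ∈ (ball 0 (R + ‖p‖) ×ˢ univ : Set (Rd d × Rd d)) := by
    rintro a ⟨ha, -⟩
    refine ⟨?_, mem_univ _⟩
    rw [mem_ball_zero_iff] at ha ⊢
    have := norm_add_le p a.1
    linarith
  refine ⟨θ, hθ, fun a ha b hb hab => h2 _ (hmem a ha) _ (hmem b hb) ?_⟩
  simpa [Prod.dist_eq] using hab

lemma IsCellSolution.isCellSub (h : IsCellSolution H δ p v) : IsCellSub (cellHam H p) δ v :=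
  h.subsolution

lemma IsCellSolution.isCellSuper (h : IsCellSolution H δ p v) : IsCellSuper (cellHam H p) δ v :=
  h.supersolution

/-- Comparison principle for the cell problem. -/
lemma cell_comparison (hreg : IsRegular H) (hcoer : IsCoercive H) (hδ : 0 < δ)
    (hv : IsCellSub (cellHam H p) δ v) (hw : IsCellSuper (cellHam H p) δ w)
    (hvb : ∃ M, ∀ y, |v y| ≤ M) (hwb : ∃ M, ∀ y, |w y| ≤ M)
    (hvc : Continuous v) (hwc : Continuous w) (y : Rd d) : v y ≤ w y := by
  obtain ⟨k, hk, hlip⟩ := hv.exists_lipschitz hδ (hcoer.cellHam p) hvc hvb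
  exact hv.le_of_isCellSuper hδ hw hvb hwb hk hlip hwc
    (fun R hR => hreg.uniformContinuousOn_cellHam p hR) y

lemma IsRegular.exists_abs_le (hreg : IsRegular H) (p : Rd d) : ∃ M, ∀ y, |H p y| ≤ M := by
  obtain ⟨M, hM⟩ := (hreg (‖p‖ + 1) (by positivity)).2
  exact ⟨M, fun y => (hM y).1 p (by simp)⟩

/-- Well-posedness of the approximate cell problem. -/
theorem existsUnique_isCellSolution (hcont : Continuous fun q : Rd d × Rd d => H q.1 q.2)
    (hreg : IsRegular H) (hcoer : IsCoercive H) (hδ : 0 < δ) (p : Rd d) :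
    ∃! v : Rd d → ℝ, IsCellSolution H δ p v := by
  obtain ⟨M, hM⟩ := hreg.exists_abs_le p
  have hc : Continuous fun q : Rd d × Rd d => cellHam H p q.1 q.2 :=
    hcont.comp (by fun_prop : Continuous fun q : Rd d × Rd d => (p + q.1, q.2))
  obtain ⟨v, hb, ⟨k, hk, hlip⟩, hsub, hsup⟩ := exists_bounded_lipschitz_solution hδ hc
    (M₀ := M) (by simpa [cellHam] using hM) (hcoer.cellHam p)
  have hvs : IsCellSolution H δ p v := by
    refine ⟨⟨_, hb⟩, ?_, hsub, hsup⟩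
    refine (LipschitzWith.of_dist_le_mul (K := k.toNNReal) fun x y => ?_).uniformContinuous
    rw [Real.dist_eq, dist_eq_norm, Real.coe_toNNReal _ hk]
    exact hlip x y
  refine ⟨v, hvs, fun w hw => funext fun y => le_antisymm ?_ ?_⟩
  · exact cell_comparison hreg hcoer hδ hw.isCellSub hsup hw.bounded ⟨_, hb⟩
      hw.uniformContinuous.continuous hvs.uniformContinuous.continuous y
  · exact cell_comparison hreg hcoer hδ hsub hw.isCellSuper ⟨_, hb⟩ hw.bounded
      hvs.uniformContinuous.continuous hw.uniformContinuous.continuous y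

/-- The constant `-c / δ` is a subsolution. Through the equation, this lower bound gives `H (p + Dv)
y ≤ c`, the source of all the slope bounds below. -/
lemma IsCellSolution.neg_le (hreg : IsRegular H) (hcoer : IsCoercive H) (hδ : 0 < δ)
    (hv : IsCellSolution H δ p v) {c : ℝ} (hc : ∀ y, H p y ≤ c) (y : Rd d) : -c ≤ δ * v y := by
  have h1 : δ * (-c / δ) = -c := by field_simp
  have h2 := cell_comparison hreg hcoer hδ
    (isCellSub_const (F := cellHam H p) (δ := δ) (c := -c / δ) fun y => by
      rw [h1, cellHam, add_zero]
      linarith [hc y]) hv.isCellSuper ⟨_, fun _ => le_rfl⟩ hv.bounded continuous_const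
    hv.uniformContinuous.continuous y
  rw [← h1]
  exact mul_le_mul_of_nonneg_left h2 hδ.le

lemma IsCellSolution.le_neg (hreg : IsRegular H) (hcoer : IsCoercive H) (hδ : 0 < δ)
    (hv : IsCellSolution H δ p v) {c : ℝ} (hc : ∀ y, c ≤ H p y) (y : Rd d) : δ * v y ≤ -c := by
  have h1 : δ * (-c / δ) = -c := by field_simp
  have h2 := cell_comparison hreg hcoer hδ hv.isCellSub
    (isCellSuper_const (F := cellHam H p) (δ := δ) (c := -c / δ) fun y => by
      rw [h1, cellHam, add_zero]
      linarith [hc y]) hv.bounded ⟨_, fun _ => le_rfl⟩ hv.uniformContinuous.continuous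
    continuous_const y
  rw [← h1]
  exact mul_le_mul_of_nonneg_left h2 hδ.le

lemma IsCellSolution.abs_mul_le (hreg : IsRegular H) (hcoer : IsCoercive H) (hδ : 0 < δ)
    (hv : IsCellSolution H δ p v) {c : ℝ} (hc : ∀ y, |H p y| ≤ c) (y : Rd d) :
    |δ * v y| ≤ c := by
  have h1 := hv.neg_le hreg hcoer hδ (fun y => (abs_le.1 (hc y)).2) y
  have h2 := hv.le_neg hreg hcoer hδ (fun y => (abs_le.1 (hc y)).1) y
  exact abs_le.2 ⟨h1, by linarith⟩

/-- Lipschitz estimate for the solution of the cell problem. -/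
lemma IsCellSolution.lipschitz (hreg : IsRegular H) (hcoer : IsCoercive H) (hδ : 0 < δ)
    (hv : IsCellSolution H δ p v) {c L : ℝ} (hc : ∀ y, H p y ≤ c) (hL : 0 < L)
    (hcL : ∀ r y, H r y ≤ c → ‖r‖ ≤ L) (x y : Rd d) :
    |v x - v y| ≤ 4 * L * ‖x - y‖ := by
  -- Both `p` and `p + Dφ` have norm at most `L`, so superdifferentials are bounded by `2L`, which
  -- `lipschitz_of_touching_bound` doubles.
  have h := lipschitz_of_touching_bound (Λ := 2 * L) (by positivity)
    hv.uniformContinuous.continuous hv.bounded (fun φ hφ z hz => by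
      have h1 := hv.subsolution φ hφ z hz
      have h2 := hv.neg_le hreg hcoer hδ hc z
      have h3 := hcL (p + gradient φ z) z (by linarith)
      have h4 := hcL p z (hc z)
      have h5 := norm_sub_le (p + gradient φ z) p
      rw [add_sub_cancel_left] at h5
      linarith) x y
  linarith

/-- Dependence of the solution of the cell problem on the slope. -/
lemma IsCellSolution.sub_le_of_slope (hreg : IsRegular H) (hcoer : IsCoercive H) (hδ : 0 < δ)
    (hv : IsCellSolution H δ p v) (hw : IsCellSolution H δ q w) {c L : ℝ}
    (hc : ∀ y, H p y ≤ c) (hcL : ∀ r y, H r y ≤ c → ‖r‖ ≤ L) {s : ℝ}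
    (hs : ∀ r, ‖r‖ ≤ L → ∀ y, H (r + (q - p)) y ≤ H r y + s) (y : Rd d) :
    δ * (v y - w y) ≤ s := by
  -- The shift `s / δ` pays for the change of slope. That change need only be controlled on `‖p + r‖
  -- ≤ L`, where the subsolution inequality puts the slopes.
  have hsub : IsCellSub (cellHam H q) δ (fun y => v y - s / δ) := by
    refine hv.isCellSub.transfer _ fun y r hr => ?_
    have h2 := hv.neg_le hreg hcoer hδ hc y
    have h3 := hs (p + r) (hcL _ y (by linarith)) y
    have h4 : δ * (v y - s / δ) = δ * v y - s := by field_simp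
    have h5 : p + r + (q - p) = q + r := by abel
    rw [h5] at h3
    rw [h4, cellHam]
    linarith
  obtain ⟨M, hM⟩ := hv.bounded
  have h1 := cell_comparison hreg hcoer hδ hsub hw.isCellSuper
    ⟨M + |s / δ|, fun y => (abs_sub _ _).trans (by linarith [hM y])⟩ hw.bounded
    (hv.uniformContinuous.continuous.sub continuous_const) hw.uniformContinuous.continuous y
  have h2 : δ * (v y - s / δ) = δ * v y - s := by field_simp
  have h3 := mul_le_mul_of_nonneg_left h1 hδ.le
  linarith

/-- Dependence of the solution of the cell problem on translations. -/
lemma IsCellSolution.translate_sub_le (hreg : IsRegular H) (hcoer : IsCoercive H) (hδ : 0 < δ)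
    (hv : IsCellSolution H δ p v) {c L : ℝ}
    (hc : ∀ y, H p y ≤ c) (hcL : ∀ r y, H r y ≤ c → ‖r‖ ≤ L) {a : Rd d} {s : ℝ}
    (hs : ∀ r, ‖r‖ ≤ L → ∀ y, H r y ≤ H r (y + a) + s) (y : Rd d) :
    δ * (v (y + a) - v y) ≤ s := by
  have h2 : ∀ t : ℝ, δ * (t - s / δ) = δ * t - s := fun t => by field_simp
  have hsub : IsCellSub (cellHam H p) δ (fun y => v (y + a) - s / δ) := by
    refine (hv.isCellSub.translate a).transfer _ fun y r hr => ?_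
    have h3 := hv.neg_le hreg hcoer hδ hc (y + a)
    have h4 := hs (p + r) (hcL _ (y + a) (by linarith)) y
    rw [h2, cellHam]
    linarith
  obtain ⟨M, hM⟩ := hv.bounded
  have h1 := cell_comparison hreg hcoer hδ hsub hv.isCellSuper
    ⟨M + |s / δ|, fun y => (abs_sub _ _).trans (by linarith [hM (y + a)])⟩ hv.bounded
    ((hv.uniformContinuous.continuous.comp (continuous_add_const a)).sub continuous_const)
    hv.uniformContinuous.continuous y
  have h3 := mul_le_mul_of_nonneg_left h1 hδ.le
  rw [h2] at h3
  linarith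

/-- The ranges of `δ v^δ` and `δ' v^δ'` cannot be separated. -/
lemma IsCellSolution.interlace (hreg : IsRegular H) (hcoer : IsCoercive H)
    (hv : IsCellSolution H δ p v) (hw : IsCellSolution H δ' p w) {a b : ℝ}
    (ha : ∀ y, δ * v y ≤ a) (hb : ∀ y, b ≤ δ' * w y) : b ≤ a := by
  obtain ⟨M, hM⟩ := hv.bounded
  obtain ⟨M', hM'⟩ := hw.bounded
  -- In an auxiliary problem of discount `γ`, shifting `w` by about `b / γ` gives a subsolution and
  -- shifting `v` by about `a / γ` a supersolution. After comparison only `γ` times bounded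
  -- quantities remain.
  have key : ∀ γ : ℝ, 0 < γ → b - a ≤ γ * (2 * M + 2 * M') := by
    intro γ hγ
    have hsub : IsCellSub (cellHam H p) γ (fun y => w y - (M' - b / γ)) := by
      refine hw.isCellSub.transfer _ fun y r hr => ?_
      have h1 := hb y
      have h2 := mul_le_mul_of_nonneg_left (abs_le.1 (hM' y)).2 hγ.le
      have h3 : γ * (w y - (M' - b / γ)) = γ * w y - γ * M' + b := by field_simp; ring
      rw [h3]
      linarith
    have hsup : IsCellSuper (cellHam H p) γ (fun y => v y + (M + a / γ)) := by
      refine hv.isCellSuper.transfer _ fun y r hr => ?_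
      have h1 := ha y
      have h2 := mul_le_mul_of_nonneg_left (abs_le.1 (hM y)).1 hγ.le
      have h3 : γ * (v y + (M + a / γ)) = γ * v y + γ * M + a := by field_simp; ring
      rw [h3]
      linarith
    have h1 := cell_comparison hreg hcoer hγ hsub hsup
      ⟨M' + |M' - b / γ|, fun y => (abs_sub _ _).trans (by linarith [hM' y])⟩
      ⟨M + |M + a / γ|, fun y => (abs_add_le _ _).trans (by linarith [hM y])⟩
      (hw.uniformContinuous.continuous.sub continuous_const)
      (hv.uniformContinuous.continuous.add continuous_const) 0
    have h2 : w 0 - M' + b / γ ≤ v 0 + M + a / γ := by linarith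
    have h3 := (abs_le.1 (hM' 0)).1
    have h4 := (abs_le.1 (hM 0)).2
    have h5 : (b - a) / γ ≤ 2 * M + 2 * M' := by
      rw [sub_div]
      linarith
    rwa [div_le_iff₀ hγ, mul_comm] at h5
  have hlim : Tendsto (fun γ : ℝ => γ * (2 * M + 2 * M')) (𝓝[>] 0) (𝓝 0) := by
    have : Continuous fun γ : ℝ => γ * (2 * M + 2 * M') := by fun_prop
    have h := this.tendsto 0
    rw [zero_mul] at h
    exact h.mono_left nhdsWithin_le_nhds
  have := ge_of_tendsto hlim (eventually_nhdsWithin_of_forall fun γ hγ => key γ hγ)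
  linarith

end

/-! ### The effective Hamiltonian -/

/-- The effective Hamiltonian associated with the solutions `v δ p` of the cell problems. -/
def effectiveHam (v : ℝ → Rd d → Rd d → ℝ) (p : Rd d) : ℝ :=
  -⨆ δ : Ioi (0 : ℝ), ⨅ y : Rd d, δ * v δ p y

section

variable {H : Rd d → Rd d → ℝ} {v : ℝ → Rd d → Rd d → ℝ}

lemma bddBelow_cell (hv : ∀ δ : ℝ, 0 < δ → ∀ p, IsCellSolution H δ p (v δ p)) (p : Rd d)
    (δ : Ioi (0 : ℝ)) : BddBelow (range fun y => (δ : ℝ) * v δ p y) := by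
  obtain ⟨M, hM⟩ := (hv δ δ.2 p).bounded
  refine ⟨δ * -M, ?_⟩
  rintro _ ⟨y, rfl⟩
  exact mul_le_mul_of_nonneg_left (abs_le.1 (hM y)).1 (le_of_lt δ.2)

/-- `interlace` compares one discount with all the others, so the supremum defining `effectiveHam`
is controlled without passing to the limit `δ → 0`. -/
lemma neg_effectiveHam_le (hreg : IsRegular H) (hcoer : IsCoercive H)
    (hv : ∀ δ : ℝ, 0 < δ → ∀ p, IsCellSolution H δ p (v δ p)) {p : Rd d} {δ a : ℝ} (hδ : 0 < δ)
    (ha : ∀ y, δ * v δ p y ≤ a) : -effectiveHam v p ≤ a := by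
  rw [effectiveHam, neg_neg]
  have : Nonempty (Ioi (0 : ℝ)) := ⟨⟨δ, hδ⟩⟩
  exact ciSup_le fun δ' => (hv δ hδ p).interlace hreg hcoer (hv δ' δ'.2 p) ha
    fun y => ciInf_le (bddBelow_cell hv p δ') y

lemma le_neg_effectiveHam (hreg : IsRegular H) (hcoer : IsCoercive H)
    (hv : ∀ δ : ℝ, 0 < δ → ∀ p, IsCellSolution H δ p (v δ p)) {p : Rd d} {δ b : ℝ} (hδ : 0 < δ)
    (hb : ∀ y, b ≤ δ * v δ p y) : b ≤ -effectiveHam v p := by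
  rw [effectiveHam, neg_neg]
  obtain ⟨M, hM⟩ := (hv δ hδ p).bounded
  refine (le_ciInf hb).trans (le_ciSup (f := fun δ : Ioi (0 : ℝ) => ⨅ y : Rd d, δ * v δ p y)
    ⟨δ * M, ?_⟩ (⟨δ, hδ⟩ : Ioi (0 : ℝ)))
  rintro _ ⟨δ', rfl⟩
  exact (hv δ hδ p).interlace hreg hcoer (hv δ' δ'.2 p)
    (fun y => mul_le_mul_of_nonneg_left (abs_le.1 (hM y)).2 hδ.le)
    fun y => ciInf_le (bddBelow_cell hv p δ') y

/-- `-Hbar(p)` lies in the range of `δ v^δ`, up to its oscillation. -/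
lemma abs_add_effectiveHam_le (hreg : IsRegular H) (hcoer : IsCoercive H)
    (hv : ∀ δ : ℝ, 0 < δ → ∀ p, IsCellSolution H δ p (v δ p)) {p : Rd d} {δ s : ℝ} (hδ : 0 < δ)
    (hs : ∀ y z, δ * (v δ p y - v δ p z) ≤ s) (y : Rd d) :
    |δ * v δ p y + effectiveHam v p| ≤ s := by
  have h1 := neg_effectiveHam_le hreg hcoer hv hδ (a := δ * v δ p y + s)
    fun z => by linarith [hs z y]
  have h2 := le_neg_effectiveHam hreg hcoer hv hδ (b := δ * v δ p y - s)
    fun z => by linarith [hs y z]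
  rw [abs_le]
  constructor <;> linarith

end

/-! ### The gradient bound -/

section

variable {H : Rd d → Rd d → ℝ} {K : ℝ}

lemma IsRegular.bddAbove (hreg : IsRegular H) (hK : 0 < K) :
    BddAbove (range fun a : ball (0 : Rd d) K × Rd d => H a.1 a.2) := by
  obtain ⟨M, hM⟩ := (hreg K hK).2
  refine ⟨M, ?_⟩
  rintro _ ⟨a, rfl⟩
  exact (abs_le.1 ((hM a.2).1 a.1 a.1.2)).2

/-- A closed condition on `B_K` extends to the closed ball. -/
lemma forall_closedBall_of_ball (hK : 0 < K) {f : Rd d → ℝ} (hf : Continuous f) {c : ℝ}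
    (h : ∀ p ∈ ball (0 : Rd d) K, f p ≤ c) {p : Rd d} (hp : ‖p‖ ≤ K) : f p ≤ c := by
  have h1 : closure (ball (0 : Rd d) K) ⊆ {p | f p ≤ c} :=
    closure_minimal h (isClosed_le hf continuous_const)
  rw [closure_ball _ hK.ne'] at h1
  exact h1 (by simpa using hp)

lemma le_iSup_ball (hcont : Continuous fun q : Rd d × Rd d => H q.1 q.2) (hreg : IsRegular H)
    (hK : 0 < K) {p : Rd d} (hp : ‖p‖ ≤ K) (y : Rd d) :
    H p y ≤ ⨆ a : ball (0 : Rd d) K × Rd d, H a.1 a.2 :=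
  forall_closedBall_of_ball hK (f := fun p => H p y) (by fun_prop)
    (fun p hp => le_ciSup (hreg.bddAbove hK) (⟨p, hp⟩, y)) hp

lemma bddAbove_gradBound_set (hcoer : IsCoercive H)
    (K : ℝ) : BddAbove {r : ℝ | ∃ q : Rd d, r = ‖q‖ ∧
    (⨅ y : Rd d, H q y) ≤ ⨆ a : ball (0 : Rd d) K × Rd d, H a.1 a.2} := by
  obtain ⟨R, hR⟩ := hcoer ((⨆ a : ball (0 : Rd d) K × Rd d, H a.1 a.2) + 1)
  refine ⟨R, ?_⟩
  rintro _ ⟨q, rfl, hq⟩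
  by_contra! hlt
  have := le_ciInf fun y => hR q hlt.le y
  linarith

/-- Converts an upper bound on `H`, as supplied by the cell equation, into the slope bound `L`. -/
lemma norm_le_gradBound (hreg : IsRegular H) (hcoer : IsCoercive H)
    {q y : Rd d}
    (h : H q y ≤ ⨆ a : ball (0 : Rd d) K × Rd d, H a.1 a.2) : ‖q‖ ≤ gradBound H K := by
  obtain ⟨M, hM⟩ := hreg.exists_abs_le q
  refine le_csSup (bddAbove_gradBound_set hcoer K) ⟨q, rfl, (ciInf_le ⟨-M, ?_⟩ y).trans h⟩
  rintro _ ⟨z, rfl⟩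
  exact (abs_le.1 (hM z)).1

/-- Positive dimension supplies a vector of norm `K`. In particular `L > 0`, so radii such as `s /
(L δ)` are meaningful. -/
lemma le_gradBound (hcont : Continuous fun q : Rd d × Rd d => H q.1 q.2) (hreg : IsRegular H) (hcoer : IsCoercive H)
    (hd : 0 < d) (hK : 0 < K) : K ≤ gradBound H K := by
  have h1 : ‖(PiLp.single 2 (⟨0, hd⟩ : Fin d) K : Rd d)‖ = K := by
    rw [PiLp.norm_single, Real.norm_of_nonneg hK.le]
  have h2 := norm_le_gradBound hreg hcoer (K := K) (q := (PiLp.single 2 (⟨0, hd⟩ : Fin d) K : Rd d))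
    (y := 0) (le_iSup_ball hcont hreg hK h1.le 0)
  rwa [h1] at h2

/-! ### The modulus of almost periodicity -/

lemma exists_bound_sub (hreg : IsRegular H)
    (hK : 0 < K) : ∃ M : ℝ, 0 ≤ M ∧
    ∀ (y z : Rd d) (q : ball (0 : Rd d) K × Rd d), |H q.1 (q.2 + y) - H q.1 (q.2 + z)| ≤ M := by
  obtain ⟨M, hM⟩ := (hreg K hK).2
  have hM0 : 0 ≤ M := (abs_nonneg _).trans ((hM 0).1 0 (mem_ball_self hK))
  refine ⟨2 * M, by positivity, fun y z q => (abs_sub _ _).trans ?_⟩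
  have h1 := (hM (q.2 + y)).1 q.1 q.1.2
  have h2 := (hM (q.2 + z)).1 q.1 q.1.2
  linarith

lemma bddBelow_rho (K R : ℝ) (y : Rd d) : BddBelow (range fun z : ball (0 : Rd d) R =>
    ⨆ q : ball (0 : Rd d) K × Rd d, |H q.1 (q.2 + y) - H q.1 (q.2 + z)|) :=
  ⟨0, by rintro _ ⟨z, rfl⟩; exact Real.iSup_nonneg fun _ => abs_nonneg _⟩

lemma rho_le (hK : 0 < K) {R s : ℝ}
    (h : ∀ y : Rd d, ∃ z : Rd d, ‖z‖ < R ∧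
      ∀ p : Rd d, ‖p‖ < K → ∀ x, |H p (x + y) - H p (x + z)| ≤ s) : rho H K R ≤ s := by
  refine ciSup_le fun y => ?_
  obtain ⟨z, hz, hs⟩ := h y
  have : Nonempty (ball (0 : Rd d) K × Rd d) := ⟨(⟨0, mem_ball_self hK⟩, 0)⟩
  refine (ciInf_le (bddBelow_rho K R y) ⟨z, by simpa using hz⟩).trans (ciSup_le fun q => ?_)
  exact hs q.1 (by simpa only [mem_ball_zero_iff] using q.1.2) q.2

/-- The strict increase from `s` to `s'` is there because the infimum over `z` need not be attained.
-/
lemma exists_translate_of_rho_le (hcont : Continuous fun q : Rd d × Rd d => H q.1 q.2) (hreg : IsRegular H)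
    (hK : 0 < K) {R s s' : ℝ} (hR : 0 < R) (hs : rho H K R ≤ s)
    (hss' : s < s') (y : Rd d) : ∃ z : Rd d, ‖z‖ < R ∧
      ∀ p : Rd d, ‖p‖ ≤ K → ∀ x, |H p (x + y) - H p (x + z)| ≤ s' := by
  obtain ⟨M, hM0, hM⟩ := exists_bound_sub hreg hK
  have : Nonempty (ball (0 : Rd d) R) := ⟨⟨0, mem_ball_self hR⟩⟩
  have : Nonempty (ball (0 : Rd d) K × Rd d) := ⟨(⟨0, mem_ball_self hK⟩, 0)⟩
  have h1 : (⨅ z : ball (0 : Rd d) R, ⨆ q : ball (0 : Rd d) K × Rd d,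
      |H q.1 (q.2 + y) - H q.1 (q.2 + z)|) < s' := by
    refine lt_of_le_of_lt (le_trans ?_ hs) hss'
    refine le_ciSup (f := fun y : Rd d => ⨅ z : ball (0 : Rd d) R,
      ⨆ q : ball (0 : Rd d) K × Rd d, |H q.1 (q.2 + y) - H q.1 (q.2 + z)|) ⟨M, ?_⟩ y
    rintro _ ⟨y, rfl⟩
    exact (ciInf_le (bddBelow_rho K R y) ⟨0, mem_ball_self hR⟩).trans (ciSup_le (hM _ _))
  obtain ⟨z, hz⟩ := exists_lt_of_ciInf_lt h1
  refine ⟨z, by simpa only [mem_ball_zero_iff] using z.2, fun p hp x => ?_⟩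
  refine forall_closedBall_of_ball hK (f := fun p => |H p (x + y) - H p (x + z)|) (by fun_prop)
    (fun p hp => ?_) hp
  have h2 : BddAbove (range fun q : ball (0 : Rd d) K × Rd d =>
      |H q.1 (q.2 + y) - H q.1 (q.2 + z)|) := ⟨M, by rintro _ ⟨q, rfl⟩; exact hM _ _ q⟩
  exact (le_ciSup h2 (⟨p, hp⟩, x)).trans hz.le

/-- Oscillation estimate for the solutions of the cell problem. -/
lemma IsCellSolution.osc_le (hcont : Continuous fun q : Rd d × Rd d => H q.1 q.2) (hreg : IsRegular H) (hcoer : IsCoercive H)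
    (hd : 0 < d) (hK : 0 < K) {δ s : ℝ} (hδ : 0 < δ) {p : Rd d}
    (hp : ‖p‖ ≤ K) {v : Rd d → ℝ} (hv : IsCellSolution H δ p v) (hs : 0 < s)
    (hrho : rho H (gradBound H K) (s / (gradBound H K * δ)) ≤ s) (y z : Rd d) :
    δ * (v y - v z) ≤ 12 * s := by
  set L := gradBound H K with hL
  have hL0 : 0 < L := hK.trans_le (le_gradBound hcont hreg hcoer hd hK)
  have hc : ∀ y, H p y ≤ ⨆ a : ball (0 : Rd d) K × Rd d, H a.1 a.2 := fun y =>
    le_iSup_ball hcont hreg hK hp y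
  have hcL : ∀ r y, (H r y ≤ ⨆ a : ball (0 : Rd d) K × Rd d, H a.1 a.2) → ‖r‖ ≤ L :=
    fun r y h => norm_le_gradBound hreg hcoer h
  have key : ∀ y, |δ * (v y - v 0)| ≤ 6 * s := by
    intro y
    -- Replacing `y` by `z` costs `2 * s`; moving from `z` to `0` costs `δ * 4L * s / (L δ) = 4 *
    -- s`. The sum `6 * s` is used once for each of the two points.
    obtain ⟨z, hz, hzs⟩ := exists_translate_of_rho_le hcont hreg hL0
      (R := s / (L * δ)) (by positivity) hrho (show s < 2 * s by linarith) y
    have h1 := hv.translate_sub_le hreg hcoer hδ hc hcL (a := y - z) (s := 2 * s)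
      (fun r hr x => by
        have := (abs_le.1 (hzs r hr (x - z))).1
        rw [sub_add_cancel, show x - z + y = x + (y - z) by abel] at this
        linarith) z
    have h2 := hv.translate_sub_le hreg hcoer hδ hc hcL (a := z - y) (s := 2 * s)
      (fun r hr x => by
        have := (abs_le.1 (hzs r hr (x - y))).2
        rw [sub_add_cancel, show x - y + z = x + (z - y) by abel] at this
        linarith) y
    rw [add_sub_cancel] at h1 h2
    have h3 := hv.lipschitz hreg hcoer hδ hc hL0 hcL z 0
    rw [sub_zero] at h3
    have h4 : δ * (4 * L * ‖z‖) ≤ 4 * s := by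
      rw [lt_div_iff₀ (by positivity)] at hz
      nlinarith
    have h5 := mul_le_mul_of_nonneg_left (abs_le.1 h3).1 hδ.le
    have h6 := mul_le_mul_of_nonneg_left (abs_le.1 h3).2 hδ.le
    rw [abs_le]
    constructor <;> nlinarith
  have h1 := (abs_le.1 (key y)).2
  have h2 := (abs_le.1 (key z)).1
  nlinarith

/-! ### The function `η` -/

lemma eta_nonneg (H : Rd d → Rd d → ℝ) (K δ : ℝ) : 0 ≤ eta H K δ :=
  mul_nonneg (by norm_num) (Real.sInf_nonneg fun _ hs => hs.1.le)

lemma eta_le {δ s : ℝ} (hs : 0 < s) (h : rho H K (s / (K * δ)) ≤ s) : eta H K δ ≤ 4 * s :=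
  mul_le_mul_of_nonneg_left (csInf_le ⟨0, fun _ ht => ht.1.le⟩ ⟨hs, h⟩) (by norm_num)

/-- Nonemptiness of the defining set matters, since `sInf ∅ = 0`; a level above a uniform bound of
the differences is always admissible, with `z = 0`. -/
lemma le_eta (hreg : IsRegular H)
    (hK : 0 < K) {δ : ℝ} (hδ : 0 < δ) {c : ℝ}
    (h : ∀ s : ℝ, 0 < s → rho H K (s / (K * δ)) ≤ s → c ≤ 4 * s) : c ≤ eta H K δ := by
  obtain ⟨M, hM0, hM⟩ := exists_bound_sub hreg hK
  have h1 : c / 4 ≤ sInf {s : ℝ | 0 < s ∧ rho H K (s / (K * δ)) ≤ s} := by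
    refine le_csInf ⟨M + 1, by positivity, rho_le hK fun y => ⟨0, ?_, fun p hp x => ?_⟩⟩ ?_
    · rw [norm_zero]; positivity
    · exact (hM y 0 (⟨p, by simpa using hp⟩, x)).trans (by linarith)
    · rintro s ⟨hs0, hs⟩
      linarith [h s hs0 hs]
  rw [eta]
  linarith

/-- Almost periodicity makes `ρ_K(R)` small for large `R`. -/
lemma IsAlmostPeriodic.exists_rho_le (hap : IsAlmostPeriodic H) (hK : 0 < K) {ω : ℝ}
    (hω : 0 < ω) : ∃ R₀ : ℝ, ∀ R, R₀ < R → rho H K R ≤ ω := by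
  have htb := (hap K hK).totallyBounded.subset subset_closure
  set T : Rd d → UniformFun (ball (0 : Rd d) K × Rd d) ℝ := fun y =>
    UniformFun.ofFun fun q : ball (0 : Rd d) K × Rd d => H q.1 (q.2 + y) with hT
  -- A finite net is chosen among the translates themselves; `R₀` bounds the translation vectors of
  -- its elements.
  obtain ⟨t, hts, htf, hcov⟩ := totallyBounded_iff_subset.1 htb _
    ((UniformFun.hasBasis_uniformity (ball (0 : Rd d) K × Rd d) ℝ).mem_of_mem
      (Metric.dist_mem_uniformity hω))
  have hex : ∀ f, ∃ y, f ∈ t → T y = f := fun f => by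
    by_cases hf : f ∈ t
    · obtain ⟨y, hy⟩ := hts hf
      exact ⟨y, fun _ => hy⟩
    · exact ⟨0, fun h => absurd h hf⟩
  choose g hg using hex
  obtain ⟨R₀, hR₀⟩ := (htf.image fun f => ‖g f‖).bddAbove
  refine ⟨R₀, fun R hR => rho_le hK fun y => ?_⟩
  obtain ⟨f, hft, hf⟩ := mem_iUnion₂.1 (hcov (mem_range_self y))
  refine ⟨g f, (hR₀ (mem_image_of_mem _ hft)).trans_lt hR, fun p hp x => ?_⟩
  rw [← hg f hft] at hf
  exact (hf (⟨p, by simpa using hp⟩, x)).le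

lemma IsAlmostPeriodic.tendsto_eta (hap : IsAlmostPeriodic H) (hK : 0 < K) :
    Tendsto (eta H K) (𝓝[>] 0) (𝓝 0) := by
  rw [tendsto_order]
  refine ⟨fun a ha => Eventually.of_forall fun δ => ha.trans_le (eta_nonneg H K δ),
    fun a ha => ?_⟩
  -- For the fixed level `s = a / 8` the radius `s / (K δ)` eventually exceeds `R₀`, so `eta` is at
  -- most `a / 2`.
  obtain ⟨R₀, hR₀⟩ := hap.exists_rho_le hK (ω := a / 8) (by positivity)
  have hev : ∀ᶠ δ : ℝ in 𝓝[>] 0, δ < a / 8 / (K * (|R₀| + 1)) :=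
    nhdsWithin_le_nhds (Iio_mem_nhds (by positivity))
  filter_upwards [hev, self_mem_nhdsWithin] with δ h1 (h2 : 0 < δ)
  refine (eta_le (s := a / 8) (by positivity) (hR₀ _ ?_)).trans_lt (by linarith)
  rw [lt_div_iff₀ (by positivity)] at h1 ⊢
  have h3 : R₀ * (K * δ) ≤ (|R₀| + 1) * (K * δ) :=
    mul_le_mul_of_nonneg_right (by linarith [le_abs_self R₀]) (by positivity)
  linarith

/-! ### Periodic Hamiltonians -/

lemma IsPeriodic.exists_translate (hper : IsPeriodic H) (y : Rd d) :
    ∃ z : Rd d, ‖z‖ ≤ √d ∧ ∀ p x, H p (x + y) = H p (x + z) := by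
  refine ⟨WithLp.toLp 2 fun i => Int.fract (y i), ?_, fun p x => ?_⟩
  · rw [EuclideanSpace.norm_eq]
    refine Real.sqrt_le_sqrt ?_
    refine (Finset.sum_le_card_nsmul _ _ 1 fun i _ => ?_).trans (by simp)
    have h0 := Int.fract_nonneg (y i)
    have h1 := Int.fract_lt_one (y i)
    simp only [Real.norm_eq_abs, sq_abs]
    nlinarith
  · have h := hper p (x + WithLp.toLp 2 fun i => Int.fract (y i)) fun i => ⌊y i⌋
    rw [← h]
    congr 1
    ext i
    simp [add_assoc, Int.fract_add_floor]

lemma IsPeriodic.isAlmostPeriodic (hreg : IsRegular H)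
    (hper : IsPeriodic H) : IsAlmostPeriodic H := by
  intro K hK
  set T : Rd d → UniformFun (ball (0 : Rd d) K × Rd d) ℝ := fun y =>
    UniformFun.ofFun fun q : ball (0 : Rd d) K × Rd d => H q.1 (q.2 + y) with hT
  have hTc : Continuous T := by
    rw [continuous_iff_continuousAt]
    intro y
    rw [ContinuousAt, UniformFun.tendsto_iff_tendstoUniformly, Metric.tendstoUniformly_iff]
    intro ε hε
    obtain ⟨θ, hθ, h⟩ := Metric.uniformContinuousOn_iff.1 (hreg K hK).1 ε hε
    filter_upwards [ball_mem_nhds y hθ] with z hz q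
    refine h (q.1, q.2 + y) ⟨q.1.2, mem_univ _⟩ (q.1, q.2 + z) ⟨q.1.2, mem_univ _⟩ ?_
    simpa [Prod.dist_eq, dist_comm] using hz
  have hrange : range T = T '' closedBall 0 √d := by
    refine Subset.antisymm ?_ (image_subset_range _ _)
    rintro _ ⟨y, rfl⟩
    obtain ⟨z, hz, h⟩ := hper.exists_translate y
    refine ⟨z, by simpa using hz, ?_⟩
    simp only [hT]
    congr 1
    funext q
    exact (h _ _).symm
  rw [hrange]
  exact ((isCompact_closedBall _ _).image hTc).closure

/-- The level `s = K δ (√d + 1)` makes the radius `s / (K δ)` exceed `√d`, where an exactly matching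
translate exists. -/
lemma IsPeriodic.eta_le (hper : IsPeriodic H) (hK : 0 < K) {δ : ℝ} (hδ : 0 < δ) :
    eta H K δ ≤ 4 * (K * (√d + 1)) * δ := by
  have h1 : 0 < K * δ * (√d + 1) := by positivity
  refine (HJ.eta_le h1 (rho_le hK fun y => ?_)).trans (by linarith)
  obtain ⟨z, hz, h⟩ := hper.exists_translate y
  refine ⟨z, ?_, fun p _ x => ?_⟩
  · rw [mul_div_cancel_left₀ _ (by positivity)]
    linarith
  · rw [h p x, sub_self, abs_zero]
    exact h1.le

end

/-! ### Evolutionary viscosity sub- and supersolutions -/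

/-- `u` is a viscosity subsolution of `u_t + G(Du, x) = 0` in `ℝ^d × (0, T)`. -/
def IsHJSub (G : Rd d → Rd d → ℝ) (T : ℝ) (u : Rd d → ℝ → ℝ) : Prop :=
  ∀ φ : Rd d × ℝ → ℝ, ContDiff ℝ 1 φ → ∀ (x : Rd d) (t : ℝ), 0 < t → t < T →
    IsLocalMax (fun z : Rd d × ℝ => u z.1 z.2 - φ z) (x, t) →
    deriv (fun s => φ (x, s)) t + G (gradient (fun y => φ (y, t)) x) x ≤ 0

/-- `u` is a viscosity supersolution of `u_t + G(Du, x) = 0` in `ℝ^d × (0, T)`. -/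
def IsHJSuper (G : Rd d → Rd d → ℝ) (T : ℝ) (u : Rd d → ℝ → ℝ) : Prop :=
  ∀ φ : Rd d × ℝ → ℝ, ContDiff ℝ 1 φ → ∀ (x : Rd d) (t : ℝ), 0 < t → t < T →
    IsLocalMin (fun z : Rd d × ℝ => u z.1 z.2 - φ z) (x, t) →
    0 ≤ deriv (fun s => φ (x, s)) t + G (gradient (fun y => φ (y, t)) x) x

section

variable {G : Rd d → Rd d → ℝ} {T K : ℝ} {u : Rd d → ℝ → ℝ} {f : Rd d → ℝ} {g : Rd d → Rd d}
  {θ : ℝ → ℝ} {θ' : ℝ}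

lemma eventually_mem_Icc {x : Rd d} {t : ℝ} (ht0 : 0 < t) (htT : t < T) :
    ∀ᶠ z : Rd d × ℝ in 𝓝 (x, t), z.2 ∈ Icc 0 T :=
  continuous_snd.continuousAt.eventually (Icc_mem_nhds ht0 htT)

/-- The doubling argument only needs test functions that split into a space part and a time part,
with maxima over the whole strip. -/
lemma IsHJSub.test (h : IsHJSub G T u) (hf : HasSmoothGradient f g) (hθ : ContDiff ℝ 1 θ)
    {x : Rd d} {t : ℝ} (hθ' : HasDerivAt θ θ' t) (ht0 : 0 < t) (htT : t < T)
    (hmax : ∀ y, ∀ s ∈ Icc 0 T, u y s - (f y + θ s) ≤ u x t - (f x + θ t)) :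
    θ' + G (g x) x ≤ 0 := by
  have h1 := h (fun z => f z.1 + θ z.2)
    ((hf.contDiff.comp contDiff_fst).add (hθ.comp contDiff_snd)) x t ht0 htT (by
      filter_upwards [eventually_mem_Icc ht0 htT] with z hz
      exact hmax z.1 z.2 hz)
  have h2 : deriv (fun s => f x + θ s) t = θ' := (hθ'.const_add (f x)).deriv
  have h3 := (hf.add (HasSmoothGradient.const (θ t))).gradient_eq x
  simp only [add_zero] at h3
  simp only [h2, h3] at h1
  exact h1

/-- This reflection reduces the lower error estimate to the upper one. -/
lemma IsHJSub.neg (h : IsHJSub G T u) :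
    IsHJSuper (fun p x => -G (-p) x) T (fun x t => -u x t) := by
  intro φ hφ x t ht0 htT hmin
  have h1 := h (fun z => -φ z) hφ.neg x t ht0 htT (by
    filter_upwards [hmin] with z hz
    linarith)
  have hg : HasSmoothGradient (fun y => φ (y, t)) _ := HasSmoothGradient.of_contDiff
    (hφ.comp (contDiff_id.prodMk contDiff_const))
  have h2 := hg.neg.gradient_eq x
  rw [h2, deriv.fun_neg] at h1
  linarith

lemma IsHJSuper.neg (h : IsHJSuper G T u) :
    IsHJSub (fun p x => -G (-p) x) T (fun x t => -u x t) := by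
  intro φ hφ x t ht0 htT hmax
  have h1 := h (fun z => -φ z) hφ.neg x t ht0 htT (by
    filter_upwards [hmax] with z hz
    linarith)
  have hg : HasSmoothGradient (fun y => φ (y, t)) _ := HasSmoothGradient.of_contDiff
    (hφ.comp (contDiff_id.prodMk contDiff_const))
  have h2 := hg.neg.gradient_eq x
  rw [h2, deriv.fun_neg] at h1
  linarith

lemma IsCellSub.neg {F : Rd d → Rd d → ℝ} {δ : ℝ} {v : Rd d → ℝ} (h : IsCellSub F δ v) :
    IsCellSuper (fun p x => -F (-p) x) δ (fun x => -v x) := by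
  intro φ hφ y hy
  have h1 := h.test (HasSmoothGradient.of_contDiff hφ).neg (y := y) (by
    filter_upwards [hy] with z hz
    linarith)
  linarith

lemma IsHJSuper.test (h : IsHJSuper G T u) (hf : HasSmoothGradient f g) (hθ : ContDiff ℝ 1 θ)
    {x : Rd d} {t : ℝ} (hθ' : HasDerivAt θ θ' t) (ht0 : 0 < t) (htT : t < T)
    (hmax : ∀ y, ∀ s ∈ Icc 0 T, -u y s - (f y + θ s) ≤ -u x t - (f x + θ t)) :
    θ' ≤ G (-g x) x := by
  have := h.neg.test hf hθ hθ' ht0 htT hmax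
  linarith

lemma IsLipschitzOnStrip.neg (h : IsLipschitzOnStrip K T u) :
    IsLipschitzOnStrip K T (fun x t => -u x t) := fun x y t ht s hs => by
  rw [neg_sub_neg, abs_sub_comm]
  exact h x y t ht s hs

lemma IsLipschitzOnStrip.continuousOn (hK : 0 ≤ K) (h : IsLipschitzOnStrip K T u) :
    ContinuousOn (fun q : Rd d × ℝ => u q.1 q.2) (univ ×ˢ Icc 0 T) := by
  refine LipschitzOnWith.continuousOn (K := (2 * K).toNNReal)
    (LipschitzOnWith.of_dist_le_mul fun q hq r hr => ?_)
  rw [Real.coe_toNNReal _ (by positivity), Real.dist_eq]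
  refine (h q.1 r.1 q.2 hq.2 r.2 hr.2).trans ?_
  have h1 : ‖q.1 - r.1‖ ≤ dist q r := by
    rw [← dist_eq_norm]; exact (le_max_left _ _)
  have h2 : |q.2 - r.2| ≤ dist q r := by
    rw [← Real.dist_eq]; exact (le_max_right _ _)
  nlinarith

lemma IsLipschitzOnStrip.space (h : IsLipschitzOnStrip K T u) {t : ℝ} (ht : t ∈ Icc 0 T)
    (x y : Rd d) : |u x t - u y t| ≤ K * ‖x - y‖ := by
  simpa using h x y t ht t ht

lemma IsLipschitzOnStrip.time (h : IsLipschitzOnStrip K T u) {t s : ℝ} (ht : t ∈ Icc 0 T)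
    (hs : s ∈ Icc 0 T) (x : Rd d) : |u x t - u x s| ≤ K * |t - s| := by
  simpa using h x x t ht s hs

end

/-- The steep penalisation `μ exp(N(t - T))` dominates linear growth near the terminal time. -/
lemma mul_le_of_exp_penalty {T μ N K c : ℝ} (hT : 0 < T) (hμ : 0 < μ) (hN : 0 < N)
    (h : ∀ η, 0 < η → η ≤ T → μ * (1 - Real.exp (-(N * η))) ≤ K * η + c * η ^ 2) :
    μ * N ≤ K := by
  have hlim : Tendsto (fun η : ℝ => (K + c * η) * (1 + N * η)) (𝓝[>] 0) (𝓝 K) := by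
    have : Continuous fun η : ℝ => (K + c * η) * (1 + N * η) := by fun_prop
    have h := this.tendsto 0
    simp only [mul_zero, add_zero, mul_one] at h
    exact h.mono_left nhdsWithin_le_nhds
  refine ge_of_tendsto hlim ?_
  filter_upwards [self_mem_nhdsWithin, nhdsWithin_le_nhds (Iio_mem_nhds hT)]
    with η (hη : 0 < η) (hηT : η < T)
  have h1 := h η hη hηT.le
  have h2 : 1 + N * η ≤ Real.exp (N * η) := by linarith [Real.add_one_le_exp (N * η)]
  -- Thus `1 - exp(-Nη) ≥ Nη / (1 + Nη)`; division by `η` and `η → 0` give the claim.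
  have h3 : Real.exp (-(N * η)) * (1 + N * η) ≤ 1 := by
    rw [Real.exp_neg, inv_mul_le_iff₀ (Real.exp_pos _)]
    linarith
  have hNη : 0 < N * η := by positivity
  have h4 : μ * (N * η) ≤ (K * η + c * η ^ 2) * (1 + N * η) := by
    have h5 := mul_le_mul_of_nonneg_right h1 (by positivity : 0 ≤ 1 + N * η)
    have h6 := mul_le_mul_of_nonneg_left h3 hμ.le
    nlinarith
  have h7 : η * (μ * N) ≤ η * ((K + c * η) * (1 + N * η)) := by linarith
  exact le_of_mul_le_mul_left h7 hη

/-! ### The perturbed test function -/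

/-- Doubling of variables with the corrector `v`, whose slope is a further variable `p`. -/
def doubled (uε u : Rd d → ℝ → ℝ) (v : Rd d → Rd d → ℝ) (b ε β γ α l μ N T : ℝ)
    (x y w p : Rd d) (t s : ℝ) : ℝ :=
  uε x t - u y s - ε * v p w - (2 * b)⁻¹ * ‖x - y‖ ^ 2 -
    (2 * b ^ 2)⁻¹ * ‖x - (y + b • p)‖ ^ 2 - (2 * γ)⁻¹ * ‖x - ε • w‖ ^ 2 -
    (2 * α)⁻¹ * (t - s) ^ 2 - β * smoothDist 1 0 x - l * t -
    μ * Real.exp (N * (t - T)) - μ * Real.exp (N * (s - T))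

section

variable {uε u : Rd d → ℝ → ℝ} {v : Rd d → Rd d → ℝ} {b ε β γ α l μ N T K M : ℝ}

/-- The variables of `doubled` are bounded on its superlevel sets. -/
lemma norm_le_of_le_doubled (hK : 0 < K) (hb : 0 < b) (hβ : 0 < β) (hγ : 0 < γ)
    (hα : 0 < α) (hl : 0 ≤ l) (hμ : 0 < μ) (hT : 0 < T)
    (huε : IsLipschitzOnStrip K T uε) (hu : IsLipschitzOnStrip K T u)
    (h0 : ∀ x, uε x 0 = u x 0) {x y w p : Rd d} {t s c : ℝ} (ht : t ∈ Icc 0 T) (hs : s ∈ Icc 0 T)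
    (hv : -M ≤ ε * v p w) (hle : c ≤ doubled uε u v b ε β γ α l μ N T x y w p t s) :
    ∃ C, C = 2 * K * T + M - c + K ^ 2 * b ∧ ‖x‖ ≤ C / β ∧ ‖x - y‖ ≤ 1 + 4 * b * C ∧
      ‖x - ε • w‖ ≤ 1 + 2 * γ * C := by
  refine ⟨_, rfl, ?_⟩
  set C := 2 * K * T + M - c + K ^ 2 * b with hC
  have e1 : uε x t - u y s ≤ 2 * K * T + K * ‖x - y‖ := by
    have hz : (0 : ℝ) ∈ Icc 0 T := ⟨le_rfl, hT.le⟩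
    have a1 := (abs_le.1 (huε.time ht hz x)).2
    have a2 := (abs_le.1 (hu.time hs hz y)).1
    have a3 := (abs_le.1 (hu.space hz x y)).2
    have a4 := h0 x
    rw [sub_zero, abs_of_nonneg ht.1] at a1
    rw [sub_zero, abs_of_nonneg hs.1] at a2
    have a5 := mul_le_mul_of_nonneg_left ht.2 hK.le
    have a6 := mul_le_mul_of_nonneg_left hs.2 hK.le
    linarith
  have e3 : 0 ≤ (2 * b ^ 2)⁻¹ * ‖x - (y + b • p)‖ ^ 2 := by positivity
  have e4 : 0 ≤ (2 * α)⁻¹ * (t - s) ^ 2 := by positivity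
  have e5 : 0 ≤ l * t := mul_nonneg hl ht.1
  have e6 : 0 ≤ μ * Real.exp (N * (t - T)) := by positivity
  have e7 : 0 ≤ μ * Real.exp (N * (s - T)) := by positivity
  -- Half of the quadratic penalty absorbs the linear growth of `u`; the other half bounds `x - y`.
  have e8 : K * ‖x - y‖ ≤ K ^ 2 * b + (4 * b)⁻¹ * ‖x - y‖ ^ 2 := by
    have : K ^ 2 * b + (4 * b)⁻¹ * ‖x - y‖ ^ 2 - K * ‖x - y‖ =
        (4 * b)⁻¹ * (‖x - y‖ - 2 * b * K) ^ 2 := by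
      field_simp; ring
    have h : 0 ≤ (4 * b)⁻¹ * (‖x - y‖ - 2 * b * K) ^ 2 := by positivity
    linarith
  have e9 : (2 * b)⁻¹ * ‖x - y‖ ^ 2 =
      (4 * b)⁻¹ * ‖x - y‖ ^ 2 + (4 * b)⁻¹ * ‖x - y‖ ^ 2 := by field_simp; ring
  have htot : β * smoothDist 1 0 x + (4 * b)⁻¹ * ‖x - y‖ ^ 2 +
      (2 * γ)⁻¹ * ‖x - ε • w‖ ^ 2 ≤ C := by
    rw [doubled] at hle
    rw [hC]
    linarith
  have f1 : 0 ≤ (4 * b)⁻¹ * ‖x - y‖ ^ 2 := by positivity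
  have f2 : 0 ≤ (2 * γ)⁻¹ * ‖x - ε • w‖ ^ 2 := by positivity
  have f3 : β * ‖x‖ ≤ β * smoothDist 1 0 x := by
    have := norm_le_smoothDist 1 0 x
    rw [sub_zero] at this
    exact mul_le_mul_of_nonneg_left this hβ.le
  have f4 : 0 ≤ β * ‖x‖ := by positivity
  refine ⟨?_, ?_, ?_⟩
  · rw [le_div_iff₀ hβ]
    linarith
  · have : (4 * b)⁻¹ * ‖x - y‖ ^ 2 ≤ C := by linarith
    rw [inv_mul_le_iff₀ (by positivity)] at this
    nlinarith [norm_nonneg (x - y)]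
  · have : (2 * γ)⁻¹ * ‖x - ε • w‖ ^ 2 ≤ C := by linarith
    rw [inv_mul_le_iff₀ (by positivity)] at this
    nlinarith [norm_nonneg (x - ε • w)]

/-- `doubled` is continuous on the set where the slope and the times are admissible. -/
lemma continuousOn_doubled (hK : 0 ≤ K) (huε : IsLipschitzOnStrip K T uε)
    (hu : IsLipschitzOnStrip K T u) (hvc : ∀ p, ‖p‖ ≤ K → Continuous (v p)) {k : NNReal}
    (hvp : ∀ p q, ‖p‖ ≤ K → ‖q‖ ≤ K → ∀ y, |v p y - v q y| ≤ k * ‖p - q‖) :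
    ContinuousOn (fun q : Rd d × Rd d × Rd d × Rd d × ℝ × ℝ =>
      doubled uε u v b ε β γ α l μ N T q.1 q.2.1 q.2.2.1 q.2.2.2.1 q.2.2.2.2.1 q.2.2.2.2.2)
      {q | ‖q.2.2.2.1‖ ≤ K ∧ q.2.2.2.2.1 ∈ Icc 0 T ∧ q.2.2.2.2.2 ∈ Icc 0 T} := by
  set S : Set (Rd d × Rd d × Rd d × Rd d × ℝ × ℝ) :=
    {q | ‖q.2.2.2.1‖ ≤ K ∧ q.2.2.2.2.1 ∈ Icc 0 T ∧ q.2.2.2.2.2 ∈ Icc 0 T} with hS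
  have hvcont : ContinuousOn (fun q : Rd d × Rd d => v q.1 q.2) (closedBall 0 K ×ˢ univ) := by
    refine continuousOn_prod_of_continuousOn_lipschitzOnWith _ k
      (fun p hp => (hvc p (by simpa using hp)).continuousOn) fun y _ => ?_
    refine LipschitzOnWith.of_dist_le_mul fun p hp q hq => ?_
    rw [Real.dist_eq, dist_eq_norm]
    exact hvp p q (by simpa using hp) (by simpa using hq) y
  have h1 : ContinuousOn (fun q : Rd d × Rd d × Rd d × Rd d × ℝ × ℝ =>
      uε q.1 q.2.2.2.2.1) S :=
    (huε.continuousOn hK).comp (f := fun q : Rd d × Rd d × Rd d × Rd d × ℝ × ℝ =>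
      (q.1, q.2.2.2.2.1)) (by fun_prop) fun q hq => ⟨mem_univ _, hq.2.1⟩
  have h2 : ContinuousOn (fun q : Rd d × Rd d × Rd d × Rd d × ℝ × ℝ =>
      u q.2.1 q.2.2.2.2.2) S :=
    (hu.continuousOn hK).comp (f := fun q : Rd d × Rd d × Rd d × Rd d × ℝ × ℝ =>
      (q.2.1, q.2.2.2.2.2)) (by fun_prop) fun q hq => ⟨mem_univ _, hq.2.2⟩
  have h3 : ContinuousOn (fun q : Rd d × Rd d × Rd d × Rd d × ℝ × ℝ =>
      ε * v q.2.2.2.1 q.2.2.1) S :=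
    continuousOn_const.mul
      (hvcont.comp (f := fun q : Rd d × Rd d × Rd d × Rd d × ℝ × ℝ =>
      (q.2.2.2.1, q.2.2.1)) (by fun_prop) fun q hq => ⟨by simpa using hq.1, mem_univ _⟩)
  have h4 : Continuous (fun q : Rd d × Rd d × Rd d × Rd d × ℝ × ℝ =>
      (2 * b)⁻¹ * ‖q.1 - q.2.1‖ ^ 2 + (2 * b ^ 2)⁻¹ * ‖q.1 - (q.2.1 + b • q.2.2.2.1)‖ ^ 2 +
      (2 * γ)⁻¹ * ‖q.1 - ε • q.2.2.1‖ ^ 2 + (2 * α)⁻¹ * (q.2.2.2.2.1 - q.2.2.2.2.2) ^ 2 +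
      β * smoothDist 1 0 q.1 + l * q.2.2.2.2.1 + μ * Real.exp (N * (q.2.2.2.2.1 - T)) +
      μ * Real.exp (N * (q.2.2.2.2.2 - T))) := by
    unfold smoothDist
    fun_prop
  refine (((h1.sub h2).sub h3).sub h4.continuousOn).congr fun q _ => ?_
  simp only [doubled, Pi.sub_apply]
  ring

lemma exists_max_doubled (hK : 0 < K) (hb : 0 < b) (hε : 0 < ε) (hβ : 0 < β) (hγ : 0 < γ)
    (hα : 0 < α) (hl : 0 ≤ l) (hμ : 0 < μ) (hT : 0 < T)
    (huε : IsLipschitzOnStrip K T uε) (hu : IsLipschitzOnStrip K T u)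
    (h0 : ∀ x, uε x 0 = u x 0)
    (hvc : ∀ p, ‖p‖ ≤ K → Continuous (v p))
    (hvb : ∀ p, ‖p‖ ≤ K → ∀ y, |ε * v p y| ≤ M)
    {k : NNReal} (hvp : ∀ p q, ‖p‖ ≤ K → ‖q‖ ≤ K → ∀ y, |v p y - v q y| ≤ k * ‖p - q‖) :
    ∃ (x y w p : Rd d) (t s : ℝ), ‖p‖ ≤ K ∧ t ∈ Icc 0 T ∧ s ∈ Icc 0 T ∧
      ∀ (x' y' w' p' : Rd d) (t' s' : ℝ), ‖p'‖ ≤ K → t' ∈ Icc 0 T → s' ∈ Icc 0 T →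
        doubled uε u v b ε β γ α l μ N T x' y' w' p' t' s' ≤
          doubled uε u v b ε β γ α l μ N T x y w p t s := by
  set S : Set (Rd d × Rd d × Rd d × Rd d × ℝ × ℝ) :=
    {q | ‖q.2.2.2.1‖ ≤ K ∧ q.2.2.2.2.1 ∈ Icc 0 T ∧ q.2.2.2.2.2 ∈ Icc 0 T} with hS
  have hSc : IsClosed S := by
    have c1 : Continuous fun q : Rd d × Rd d × Rd d × Rd d × ℝ × ℝ => ‖q.2.2.2.1‖ := by fun_prop
    have c2 : Continuous fun q : Rd d × Rd d × Rd d × Rd d × ℝ × ℝ => q.2.2.2.2.1 := by fun_prop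
    have c3 : Continuous fun q : Rd d × Rd d × Rd d × Rd d × ℝ × ℝ => q.2.2.2.2.2 := by fun_prop
    exact (isClosed_le c1 continuous_const).inter
      ((isClosed_Icc.preimage c2).inter (isClosed_Icc.preimage c3))
  have h0S : (0 : Rd d × Rd d × Rd d × Rd d × ℝ × ℝ) ∈ S := by
    simp [hS, hK.le, hT.le]
  obtain ⟨C, hC⟩ : ∃ C, C = 2 * K * T + M - doubled uε u v b ε β γ α l μ N T 0 0 0 0 0 0 +
    K ^ 2 * b := ⟨_, rfl⟩
  obtain ⟨⟨x, y, w, p, t, s⟩, hq, hmax⟩ := exists_max_of_bounded_superlevel hSc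
    (continuousOn_doubled (b := b) (ε := ε) (β := β) (γ := γ) (α := α) (l := l) (μ := μ) (N := N)
      hK.le huε hu hvc hvp) h0S
    (R := C / β + (1 + 4 * b * C) + ε⁻¹ * (C / β + (1 + 2 * γ * C)) + K + T) (by
      rintro ⟨x, y, w, p, t, s⟩ ⟨hp, ht, hs⟩ hle
      simp only at hp ht hs
      obtain ⟨C', hC', g1, g2, g3⟩ := norm_le_of_le_doubled hK hb hβ hγ hα hl hμ hT huε hu h0
        ht hs (abs_le.1 (hvb p hp w)).1 hle
      obtain rfl : C' = C := hC'.trans hC.symm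
      have g4 : ‖y‖ ≤ ‖x‖ + ‖x - y‖ := by simpa using norm_sub_le x (x - y)
      have g5 : ‖w‖ ≤ ε⁻¹ * (C' / β + (1 + 2 * γ * C')) := by
        rw [le_inv_mul_iff₀ hε]
        have h1 : ‖ε • w‖ ≤ ‖x‖ + ‖x - ε • w‖ := by simpa using norm_sub_le x (x - ε • w)
        rw [norm_smul, Real.norm_of_nonneg hε.le] at h1
        linarith
      have k1 := (norm_nonneg x).trans g1
      have k2 := (norm_nonneg (x - y)).trans g2
      have k3 := (norm_nonneg w).trans g5
      have t1 : ‖t‖ ≤ T := by rw [Real.norm_of_nonneg ht.1]; exact ht.2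
      have s1 : ‖s‖ ≤ T := by rw [Real.norm_of_nonneg hs.1]; exact hs.2
      simp only [Prod.norm_def]
      refine max_le ?_ (max_le ?_ (max_le ?_ (max_le ?_ (max_le ?_ ?_)))) <;> linarith)
  exact ⟨x, y, w, p, t, s, hq.1, hq.2.1, hq.2.2, fun x' y' w' p' t' s' hp ht hs =>
    hmax (x', y', w', p', t', s') ⟨hp, ht, hs⟩⟩

end

/-! ### Estimates at a maximum point of the doubled function. -/

/-- `(x, y, w, p, t, s)` is a maximum point of `doubled`. -/
structure IsDoubledMax (uε u : Rd d → ℝ → ℝ) (v : Rd d → Rd d → ℝ) (b ε β γ α l μ N T K : ℝ)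
    (x y w p : Rd d) (t s : ℝ) : Prop where
  norm_le : ‖p‖ ≤ K
  mem_left : t ∈ Icc 0 T
  mem_right : s ∈ Icc 0 T
  le : ∀ (x' y' w' p' : Rd d) (t' s' : ℝ), ‖p'‖ ≤ K → t' ∈ Icc 0 T → s' ∈ Icc 0 T →
    doubled uε u v b ε β γ α l μ N T x' y' w' p' t' s' ≤
      doubled uε u v b ε β γ α l μ N T x y w p t s

/-- The common slope of the two solutions at a maximum point of `doubled`. -/
abbrev doubledSlope (b : ℝ) (x y p : Rd d) : Rd d :=
  b⁻¹ • (x - y) + (b ^ 2)⁻¹ • (x - (y + b • p))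

lemma inv_two_mul_smul_two_smul (c : ℝ) (x : Rd d) :
    (2 * c)⁻¹ • (2 : ℝ) • x = c⁻¹ • x := by
  rw [smul_smul]
  congr 1
  field_simp

namespace IsDoubledMax

variable {uε u : Rd d → ℝ → ℝ} {v : Rd d → Rd d → ℝ} {b ε β γ α l μ N T K M : ℝ}
  {x y w p : Rd d} {t s : ℝ}

lemma hasSmoothGradient_right (b : ℝ) (x p : Rd d) :
    HasSmoothGradient
      (fun z => (2 * b)⁻¹ * ‖z - x‖ ^ 2 + (2 * b ^ 2)⁻¹ * ‖z - (x - b • p)‖ ^ 2)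
      (fun z => -doubledSlope b x z p) := by
  have h := ((HasSmoothGradient.norm_sub_sq x).const_mul (2 * b)⁻¹).add
    ((HasSmoothGradient.norm_sub_sq (x - b • p)).const_mul (2 * b ^ 2)⁻¹)
  convert h using 2 with z
  rw [inv_two_mul_smul_two_smul, inv_two_mul_smul_two_smul, doubledSlope, neg_add, ← smul_neg,
    ← smul_neg]
  congr 2 <;> abel

/-- Since `|x - (z + b p)| = |z - (x - b p)|`, the terms depending on `(y, s)` form a split test
function touching `-u`. -/
lemma le_right (h : IsDoubledMax uε u v b ε β γ α l μ N T K x y w p t s) (z : Rd d) {r : ℝ}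
    (hr : r ∈ Icc 0 T) :
    -u z r - (((2 * b)⁻¹ * ‖z - x‖ ^ 2 + (2 * b ^ 2)⁻¹ * ‖z - (x - b • p)‖ ^ 2) +
      ((2 * α)⁻¹ * (t - r) ^ 2 + μ * Real.exp (N * (r - T)))) ≤
    -u y s - (((2 * b)⁻¹ * ‖y - x‖ ^ 2 + (2 * b ^ 2)⁻¹ * ‖y - (x - b • p)‖ ^ 2) +
      ((2 * α)⁻¹ * (t - s) ^ 2 + μ * Real.exp (N * (s - T)))) := by
  have h1 := h.le x z w p t r h.norm_le h.mem_left hr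
  simp only [doubled] at h1
  have e : ∀ z : Rd d, ‖x - (z + b • p)‖ = ‖z - (x - b • p)‖ := fun z => by
    rw [← norm_neg]; congr 1; abel
  rw [e, e, norm_sub_rev x z, norm_sub_rev x y] at h1
  linarith

lemma norm_slope_le (hK : 0 ≤ K) (hu : IsLipschitzOnStrip K T u)
    (h : IsDoubledMax uε u v b ε β γ α l μ N T K x y w p t s) :
    ‖doubledSlope b x y p‖ ≤ K := by
  have h1 := (hasSmoothGradient_right b x p).norm_le_of_touching (u := fun z => -u z s) hK
    (hu.neg.space h.mem_right) (x := y) (Eventually.of_forall fun z => by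
      have := h.le_right z h.mem_right
      simp only
      linarith)
  simpa only [norm_neg] using h1

/-- This makes `(x - y) / b` an admissible competitor for `p` in `norm_slope_sub_le`. It follows
from `(b + 1) (x - y) = b ^ 2 A + b p`, where the slope `A` and `p` are both bounded by `K`. -/
lemma norm_sub_le (hK : 0 ≤ K) (hb : 0 < b) (hu : IsLipschitzOnStrip K T u)
    (h : IsDoubledMax uε u v b ε β γ α l μ N T K x y w p t s) : ‖x - y‖ ≤ b * K := by
  have h1 : (b + 1) • (x - y) = b ^ 2 • doubledSlope b x y p + b • p := by
    rw [doubledSlope, smul_add, smul_smul, smul_smul, mul_inv_cancel₀ (by positivity), one_smul,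
      show b ^ 2 * b⁻¹ = b by field_simp, add_smul, one_smul]
    abel
  have h2 := norm_add_le (b ^ 2 • doubledSlope b x y p) (b • p)
  rw [← h1, norm_smul, norm_smul, norm_smul, Real.norm_of_nonneg (by positivity),
    Real.norm_of_nonneg (by positivity), Real.norm_of_nonneg hb.le] at h2
  have h3 := mul_le_mul_of_nonneg_left (h.norm_slope_le hK hu) (by positivity : 0 ≤ b ^ 2)
  have h4 := mul_le_mul_of_nonneg_left h.norm_le hb.le
  have h5 : (b + 1) * ‖x - y‖ ≤ (b + 1) * (b * K) := by linarith
  exact le_of_mul_le_mul_left h5 (by positivity)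

/-- Maximality in `p` is tested against `a = (x - y) / b`. The penalty equals `‖a - p‖ ^ 2 / 2` and
`b ^ 3 v` is `M b ^ 2`-Lipschitz in `p`, so `‖a - p‖ ≤ 2 M b ^ 2`; the slope differs from `p` by `(1
+ 1 / b) (a - p)`. -/
lemma norm_slope_sub_le (hK : 0 ≤ K) (hb : 0 < b) (hb1 : b ≤ 1) (hM : 0 ≤ M)
    (hu : IsLipschitzOnStrip K T u)
    (hvp : ∀ p q, ‖p‖ ≤ K → ‖q‖ ≤ K → ∀ y, |b * (v p y - v q y)| ≤ M * ‖p - q‖)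
    (h : IsDoubledMax uε u v b (b ^ 3) β γ α l μ N T K x y w p t s) :
    ‖doubledSlope b x y p - p‖ ≤ 4 * M * b := by
  set a : Rd d := b⁻¹ • (x - y) with ha
  have hba : b • a = x - y := by rw [ha, smul_smul, mul_inv_cancel₀ hb.ne', one_smul]
  have haK : ‖a‖ ≤ K := by
    rw [ha, norm_smul, norm_inv, Real.norm_of_nonneg hb.le, inv_mul_le_iff₀ hb]
    exact h.norm_sub_le hK hb hu
  have h1 := h.le x y w a t s haK h.mem_left h.mem_right
  simp only [doubled] at h1
  have e1 : x - (y + b • a) = 0 := by rw [hba]; abel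
  have e2 : x - (y + b • p) = b • (a - p) := by rw [smul_sub, hba]; abel
  rw [e1, e2, norm_zero, norm_smul, Real.norm_of_nonneg hb.le] at h1
  have h2 := (abs_le.1 (hvp a p haK h.norm_le w)).2
  have h3 := mul_le_mul_of_nonneg_left h2 (by positivity : 0 ≤ b ^ 2)
  have e3 : (2 * b ^ 2)⁻¹ * (b * ‖a - p‖) ^ 2 = ‖a - p‖ ^ 2 / 2 := by field_simp
  rw [e3] at h1
  have h4 : ‖a - p‖ ^ 2 ≤ 2 * M * b ^ 2 * ‖a - p‖ := by nlinarith
  have h5 : ‖a - p‖ ≤ 2 * M * b ^ 2 := by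
    by_contra! hlt
    have : 0 < ‖a - p‖ := lt_of_le_of_lt (by positivity) hlt
    nlinarith
  have h6 : doubledSlope b x y p - p = (1 + b⁻¹) • (a - p) := by
    rw [doubledSlope, e2, ← ha, smul_smul, show (b ^ 2)⁻¹ * b = b⁻¹ by field_simp, add_smul,
      one_smul]
    abel
  rw [h6, norm_smul, Real.norm_of_nonneg (by positivity)]
  calc (1 + b⁻¹) * ‖a - p‖ ≤ (1 + b⁻¹) * (2 * M * b ^ 2) := by gcongr
    _ = 2 * M * b * (b + 1) := by field_simp
    _ ≤ 2 * M * b * (1 + 1) := by gcongr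
    _ = 4 * M * b := by ring

lemma left_lt (hl : 0 ≤ l) (hα : 0 < α) (hT : 0 < T) (hμ : 0 < μ) (hN : 0 < N)
    (hμN : K < μ * N) (huε : IsLipschitzOnStrip K T uε)
    (h : IsDoubledMax uε u v b ε β γ α l μ N T K x y w p t s) : t < T := by
  refine lt_of_le_of_ne h.mem_left.2 fun htT => hμN.not_ge ?_
  -- If `t = T`, stepping back to `T - η` gains from the steep exponential, while `uε` loses at most
  -- `K η` and the time penalty at most `(2 * α)⁻¹ * η ^ 2`.
  refine mul_le_of_exp_penalty (c := (2 * α)⁻¹) hT hμ hN fun η hη hηT => ?_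
  have hmem : T - η ∈ Icc 0 T := ⟨by linarith, by linarith⟩
  have h1 := h.le x y w p (T - η) s h.norm_le hmem h.mem_right
  have h2 := (abs_le.1 (huε.time h.mem_left hmem x)).2
  simp only [doubled] at h1
  rw [htT] at h1 h2
  rw [show T - η - T = -η by ring, sub_self, mul_zero, Real.exp_zero, mul_neg] at h1
  rw [sub_sub_cancel, abs_of_pos hη] at h2
  have h3 : 0 ≤ (2 * α)⁻¹ * (2 * η * (T - s)) :=
    mul_nonneg (by positivity) (mul_nonneg (by positivity) (by linarith [h.mem_right.2]))
  have h4 : 0 ≤ l * η := by positivity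
  nlinarith

lemma right_lt (hα : 0 < α) (hT : 0 < T) (hμ : 0 < μ) (hN : 0 < N)
    (hμN : K < μ * N) (hu : IsLipschitzOnStrip K T u)
    (h : IsDoubledMax uε u v b ε β γ α l μ N T K x y w p t s) : s < T := by
  refine lt_of_le_of_ne h.mem_right.2 fun hsT => hμN.not_ge ?_
  refine mul_le_of_exp_penalty (c := (2 * α)⁻¹) hT hμ hN fun η hη hηT => ?_
  have hmem : T - η ∈ Icc 0 T := ⟨by linarith, by linarith⟩
  have h1 := h.le_right y hmem
  have h2 := (abs_le.1 (hu.time h.mem_right hmem y)).1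
  rw [hsT] at h1 h2
  rw [show T - η - T = -η by ring, sub_self, mul_zero, Real.exp_zero, mul_neg] at h1
  rw [sub_sub_cancel, abs_of_pos hη] at h2
  have h3 : 0 ≤ (2 * α)⁻¹ * (2 * η * (T - t)) :=
    mul_nonneg (by positivity) (mul_nonneg (by positivity) (by linarith [h.mem_left.2]))
  nlinarith

/-- The viscosity inequalities at an interior maximum bound the time slope `l`. -/
lemma slope_le {F : Rd d → Rd d → ℝ} {Fbar : Rd d → ℝ} {E θ ω : ℝ}
    (hK : 0 < K) (hb : 0 < b) (hb1 : b ≤ 1) (hM : 0 ≤ M) (hβ : 0 < β) (hβ1 : β ≤ 1) (hγ : 0 < γ)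
    (hμ : 0 < μ) (hN : 0 < N)
    (huε : IsLipschitzOnStrip K T uε) (hu : IsLipschitzOnStrip K T u)
    (hsub : IsHJSub (fun p x => F p ((b ^ 3)⁻¹ • x)) T uε) (hsup : IsHJSuper (fun p _ => Fbar p) T u)
    (hvp : ∀ p q, ‖p‖ ≤ K → ‖q‖ ≤ K → ∀ y, |b * (v p y - v q y)| ≤ M * ‖p - q‖)
    (hvsup : ∀ p, ‖p‖ ≤ K → IsCellSuper (cellHam F p) b (v p))
    (hvE : ∀ p, ‖p‖ ≤ K → ∀ y, b * v p y + Fbar p ≤ E)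
    (hFl : ∀ p ∈ ball (0 : Rd d) (3 * K + 2), ∀ q ∈ ball (0 : Rd d) (3 * K + 2), ∀ y,
      |F p y - F q y| ≤ M * ‖p - q‖)
    (hFbar : ∀ p q, ‖p‖ ≤ K → ‖q‖ ≤ K → |Fbar p - Fbar q| ≤ M * ‖p - q‖)
    (hmod : ∀ a ∈ (ball 0 (3 * K + 2) ×ˢ univ : Set (Rd d × Rd d)),
      ∀ c ∈ (ball 0 (3 * K + 2) ×ˢ univ : Set (Rd d × Rd d)), dist a c < θ →
        dist (F a.1 a.2) (F c.1 c.2) < ω)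
    (hβθ : β < θ) (hγθ : (b ^ 3)⁻¹ * (γ * (2 * K + 1)) < θ)
    (h : IsDoubledMax uε u v b (b ^ 3) β γ α l μ N T K x y w p t s)
    (ht0 : 0 < t) (htT : t < T) (hs0 : 0 < s) (hsT : s < T) :
    l ≤ 8 * M ^ 2 * b + E + ω := by
  set A := doubledSlope b x y p with hA
  set q : Rd d := γ⁻¹ • (x - b ^ 3 • w) with hq
  set n : Rd d := (smoothDist 1 0 x)⁻¹ • x with hn
  have hAK : ‖A‖ ≤ K := h.norm_slope_le hK.le hu
  have hAp : ‖A - p‖ ≤ 4 * M * b := h.norm_slope_sub_le hK.le hb hb1 hM hu hvp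
  have hn1 : ‖β • n‖ ≤ β := by
    have : ‖n‖ ≤ 1 := by simpa using norm_smoothDist_gradient_le 1 0 x
    rw [norm_smul, Real.norm_of_nonneg hβ.le]
    nlinarith
  have hexp : ∀ r, HasDerivAt (fun r => μ * Real.exp (N * (r - T)))
      (μ * (Real.exp (N * (r - T)) * N)) r := fun r => by
    have := (((hasDerivAt_id r).sub_const T).const_mul N).exp.const_mul μ
    simpa using this
  have hsq : ∀ c r, HasDerivAt (fun r => (2 * α)⁻¹ * (r - c) ^ 2) (α⁻¹ * (r - c)) r := fun c r => by
    refine ((((hasDerivAt_id' r).sub_const c).pow 2).const_mul (2 * α)⁻¹).congr_deriv ?_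
    push_cast
    ring
  have hgx : HasSmoothGradient (fun z => (2 * b)⁻¹ * ‖z - y‖ ^ 2 +
      (2 * b ^ 2)⁻¹ * ‖z - (y + b • p)‖ ^ 2 + (2 * γ)⁻¹ * ‖z - b ^ 3 • w‖ ^ 2 +
      β * smoothDist 1 0 z)
      (fun z => doubledSlope b z y p + γ⁻¹ • (z - b ^ 3 • w) +
        β • (smoothDist 1 0 z)⁻¹ • z) := by
    have := ((((HasSmoothGradient.norm_sub_sq y).const_mul (2 * b)⁻¹).add
      ((HasSmoothGradient.norm_sub_sq (y + b • p)).const_mul (2 * b ^ 2)⁻¹)).add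
      ((HasSmoothGradient.norm_sub_sq (b ^ 3 • w)).const_mul (2 * γ)⁻¹)).add
      ((HasSmoothGradient.sqrt_norm_sub_sq (0 : Rd d) one_pos).const_mul β)
    convert this using 2 with z
    simp only [doubledSlope, smoothDist, inv_two_mul_smul_two_smul, sub_zero]
  have hleft : ∀ z, ∀ r ∈ Icc 0 T, uε z r - (((2 * b)⁻¹ * ‖z - y‖ ^ 2 +
      (2 * b ^ 2)⁻¹ * ‖z - (y + b • p)‖ ^ 2 + (2 * γ)⁻¹ * ‖z - b ^ 3 • w‖ ^ 2 +
      β * smoothDist 1 0 z) + ((2 * α)⁻¹ * (r - s) ^ 2 + l * r + μ * Real.exp (N * (r - T)))) ≤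
      uε x t - (((2 * b)⁻¹ * ‖x - y‖ ^ 2 +
      (2 * b ^ 2)⁻¹ * ‖x - (y + b • p)‖ ^ 2 + (2 * γ)⁻¹ * ‖x - b ^ 3 • w‖ ^ 2 +
      β * smoothDist 1 0 x) + ((2 * α)⁻¹ * (t - s) ^ 2 + l * t + μ * Real.exp (N * (t - T)))) := by
    intro z r hr
    have h1 := h.le z y w p r s h.norm_le hr h.mem_right
    simp only [doubled] at h1
    linarith
  have hslope : ‖A + q + β • n‖ ≤ K :=
    hgx.norm_le_of_touching (u := fun z => uε z t) hK.le (huε.space h.mem_left) (x := x)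
      (Eventually.of_forall fun z => by
        have := hleft z t h.mem_left
        simp only
        linarith)
  -- The full gradient `A + q + β n` and `A` are both bounded by `K`, so `q` is bounded
  -- independently of `γ`. Hence `w` is close to `x / ε` for small `γ`.
  have hqn : ‖q‖ ≤ 2 * K + 1 := by
    have h1 : q = (A + q + β • n) - A - β • n := by abel
    have h2 := _root_.norm_sub_le ((A + q + β • n) - A) (β • n)
    have h3 := _root_.norm_sub_le (A + q + β • n) A
    rw [← h1] at h2
    linarith
  have hxw : ‖(b ^ 3)⁻¹ • x - w‖ < θ := by
    have h1 : (b ^ 3)⁻¹ • x - w = (b ^ 3)⁻¹ • γ • q := by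
      rw [hq, smul_smul γ, mul_inv_cancel₀ hγ.ne', one_smul, smul_sub, smul_smul _ (b ^ 3),
        inv_mul_cancel₀ (by positivity), one_smul]
    rw [h1, norm_smul, norm_smul, Real.norm_of_nonneg (by positivity), Real.norm_of_nonneg hγ.le]
    refine lt_of_le_of_lt ?_ hγθ
    gcongr
  have hE1 : (α⁻¹ * (t - s) + l + μ * (Real.exp (N * (t - T)) * N)) +
      F (A + q + β • n) ((b ^ 3)⁻¹ • x) ≤ 0 := by
    refine hsub.test hgx (θ := fun r => (2 * α)⁻¹ * (r - s) ^ 2 + l * r +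
      μ * Real.exp (N * (r - T))) (by fun_prop) ?_ ht0 htT hleft
    have := ((hsq s t).add ((hasDerivAt_id' t).const_mul l)).add (hexp t)
    rw [mul_one] at this
    exact this
  have hE2 : α⁻¹ * (s - t) + μ * (Real.exp (N * (s - T)) * N) ≤ Fbar A := by
    have h1 := hsup.test (hasSmoothGradient_right b x p) (θ := fun r => (2 * α)⁻¹ * (r - t) ^ 2 +
      μ * Real.exp (N * (r - T))) (by fun_prop) ((hsq t s).add (hexp s)) hs0 hsT
      (fun z r hr => by
        have := h.le_right z hr
        rw [← neg_sub r t, ← neg_sub s t, neg_sq, neg_sq] at this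
        exact this)
    simpa using h1
  -- Maximality in `w` means that `v p` is touched from below with gradient `q`: the fast gradient
  -- seen by `uε` is the corrector's.
  have hE3 : 0 ≤ b * v p w + F (p + q) w := by
    have hg := (HasSmoothGradient.norm_sub_sq ((b ^ 3)⁻¹ • x)).const_mul (-(b ^ 3 * (2 * γ)⁻¹))
    have h1 := (hvsup p h.norm_le).test hg (y := w) (Eventually.of_forall fun z => by
      have h1 := h.le x y z p t s h.norm_le h.mem_left h.mem_right
      simp only [doubled] at h1
      have e : ∀ z : Rd d, ‖x - b ^ 3 • z‖ ^ 2 = (b ^ 3) ^ 2 * ‖z - (b ^ 3)⁻¹ • x‖ ^ 2 := by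
        intro z
        have : x - b ^ 3 • z = -(b ^ 3 • (z - (b ^ 3)⁻¹ • x)) := by
          rw [smul_sub, smul_smul, mul_inv_cancel₀ (by positivity), one_smul]
          abel
        rw [this, norm_neg, norm_smul, Real.norm_of_nonneg (by positivity), mul_pow]
      rw [e, e] at h1
      have hb3 : 0 < b ^ 3 := by positivity
      refine le_of_mul_le_mul_left ?_ hb3
      linarith)
    convert h1 using 3
    rw [hq, smul_smul, show -(b ^ 3 * (2 * γ)⁻¹) * 2 = -(γ⁻¹ * b ^ 3) by field_simp, neg_smul,
      mul_smul, ← smul_neg, smul_sub (b ^ 3), smul_smul (b ^ 3), mul_inv_cancel₀ (by positivity),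
      one_smul, neg_sub]
  have hp := h.norm_le
  have hpq : p + q ∈ ball (0 : Rd d) (3 * K + 2) := by
    rw [mem_ball_zero_iff]
    have := norm_add_le p q
    linarith
  have hAq : A + q ∈ ball (0 : Rd d) (3 * K + 2) := by
    rw [mem_ball_zero_iff]
    have := norm_add_le A q
    linarith
  have hAqn : A + q + β • n ∈ ball (0 : Rd d) (3 * K + 2) := by
    rw [mem_ball_zero_iff]
    linarith
  have h1 := (abs_le.1 (hFl _ hpq _ hAq w)).2
  have h2 := hmod (A + q, w) ⟨hAq, mem_univ _⟩ (A + q + β • n, (b ^ 3)⁻¹ • x)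
    ⟨hAqn, mem_univ _⟩ (by
      rw [Prod.dist_eq]
      refine max_lt ?_ ?_
      · simp only [dist_self_add_right]
        linarith
      · simp only
        rwa [dist_comm, dist_eq_norm])
  rw [Real.dist_eq] at h2
  have h3 := (abs_lt.1 h2).2
  have h4 := (abs_le.1 (hFbar A p hAK hp)).2
  have h5 := hvE p hp w
  rw [add_sub_add_right_eq_sub, norm_sub_rev] at h1
  have h6 := mul_le_mul_of_nonneg_left hAp hM
  have h7 : 0 < μ * (Real.exp (N * (t - T)) * N) := by positivity
  have h8 : 0 < μ * (Real.exp (N * (s - T)) * N) := by positivity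
  simp only at h3
  have h9 : α⁻¹ * (t - s) = -(α⁻¹ * (s - t)) := by ring
  -- In the sum of `hE1`, `hE2`, `hE3` the `α` terms cancel and the exponential terms have a
  -- favourable sign. Replacing `A` by `p` in `F` and in `Fbar` costs `4 M ^ 2 b` each.
  nlinarith

end IsDoubledMax

/-- One-sided error estimate by means of approximate correctors. -/
theorem sub_le_of_correctors {F : Rd d → Rd d → ℝ} {Fbar : Rd d → ℝ} {uε u : Rd d → ℝ → ℝ}
    {v : Rd d → Rd d → ℝ} {b T K M E : ℝ}
    (hK : 0 < K) (hb : 0 < b) (hb1 : b ≤ 1) (hM : 0 ≤ M) (hE : 0 ≤ E) (hT : 0 < T)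
    (huε : IsLipschitzOnStrip K T uε) (hu : IsLipschitzOnStrip K T u)
    (h0 : ∀ x, uε x 0 = u x 0)
    (hsub : IsHJSub (fun p x => F p ((b ^ 3)⁻¹ • x)) T uε) (hsup : IsHJSuper (fun p _ => Fbar p) T u)
    (hvc : ∀ p, ‖p‖ ≤ K → Continuous (v p))
    (hvb : ∀ p, ‖p‖ ≤ K → ∀ y, |b * v p y| ≤ M)
    (hvp : ∀ p q, ‖p‖ ≤ K → ‖q‖ ≤ K → ∀ y, |b * (v p y - v q y)| ≤ M * ‖p - q‖)
    (hvsup : ∀ p, ‖p‖ ≤ K → IsCellSuper (cellHam F p) b (v p))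
    (hvE : ∀ p, ‖p‖ ≤ K → ∀ y, b * v p y + Fbar p ≤ E)
    (hFl : ∀ p ∈ ball (0 : Rd d) (3 * K + 2), ∀ q ∈ ball (0 : Rd d) (3 * K + 2), ∀ y,
      |F p y - F q y| ≤ M * ‖p - q‖)
    (hFu : UniformContinuousOn (fun q : Rd d × Rd d => F q.1 q.2) (ball 0 (3 * K + 2) ×ˢ univ))
    (hFbar : ∀ p q, ‖p‖ ≤ K → ‖q‖ ≤ K → |Fbar p - Fbar q| ≤ M * ‖p - q‖)
    (x₀ : Rd d) {t₀ : ℝ} (ht₀ : t₀ ∈ Icc 0 T) :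
    uε x₀ t₀ - u x₀ t₀ ≤ K ^ 2 * b + 2 * M * b ^ 2 + (8 * M ^ 2 * b + E) * T := by
  have key : ∀ ω : ℝ, 0 < ω → uε x₀ t₀ - u x₀ t₀ ≤
      (K ^ 2 * b + 2 * M * b ^ 2 + (8 * M ^ 2 * b + E) * T) + ω * (4 + 2 * T) := by
    intro ω hω
    obtain ⟨θ, hθ, hmod⟩ := Metric.uniformContinuousOn_iff.1 hFu ω hω
    have hJ : 0 < smoothDist 1 0 x₀ := Real.sqrt_pos.2 (by positivity)
    set β : ℝ := min (min 1 (θ / 2)) (ω / smoothDist 1 0 x₀) with hβ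
    have hβ0 : 0 < β := by positivity
    have hβ1 : β ≤ 1 := (min_le_left _ _).trans (min_le_left _ _)
    have hβθ : β ≤ θ / 2 := (min_le_left _ _).trans (min_le_right _ _)
    have hβω : β * smoothDist 1 0 x₀ ≤ ω := by
      rw [← le_div_iff₀ hJ]
      exact min_le_right _ _
    set γ : ℝ := b ^ 3 * (θ / (2 * K + 2)) with hγ
    have hγ0 : 0 < γ := by positivity
    have hγθ : (b ^ 3)⁻¹ * (γ * (2 * K + 1)) < θ := by
      have : (b ^ 3)⁻¹ * (γ * (2 * K + 1)) = θ * ((2 * K + 1) / (2 * K + 2)) := by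
        rw [hγ]; field_simp
      rw [this]
      have h1 : (2 * K + 1) / (2 * K + 2) < 1 := by
        rw [div_lt_one (by positivity)]; linarith
      nlinarith
    -- With this `α`, the maximum over `r` of `K r - r ^ 2 / (2 α)` is `K ^ 2 α / 2 = ω`.
    set α : ℝ := 2 * ω / K ^ 2 with hα
    have hα0 : 0 < α := by positivity
    have hαK : K ^ 2 * α = 2 * ω := by rw [hα]; field_simp
    set N : ℝ := (K + 1) / ω with hN
    have hN0 : 0 < N := by positivity
    have hωN : K < ω * N := by
      have : ω * N = K + 1 := by rw [hN]; field_simp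
      linarith
    -- By `slope_le` an interior maximum would force `l ≤ 8 * M ^ 2 * b + E + ω`; the extra `ω`
    -- excludes it, so `t = 0` or `s = 0`.
    set l : ℝ := 8 * M ^ 2 * b + E + 2 * ω with hl
    have hl0 : 0 ≤ l := by positivity
    have hvb' : ∀ p, ‖p‖ ≤ K → ∀ y, |b ^ 3 * v p y| ≤ M * b ^ 2 := fun p hp y => by
      rw [show b ^ 3 * v p y = (b * v p y) * b ^ 2 by ring, abs_mul,
        abs_of_pos (by positivity : 0 < b ^ 2)]
      exact mul_le_mul_of_nonneg_right (hvb p hp y) (by positivity)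
    obtain ⟨x, y, w, p, t, s, hp, ht, hs, hle⟩ := exists_max_doubled (ε := b ^ 3) (β := β)
      (γ := γ) (α := α) (l := l) (μ := ω) (N := N) (k := (M / b).toNNReal) hK hb (by positivity)
      hβ0 hγ0 hα0 hl0 hω hT huε hu h0 hvc hvb' (fun p q hp hq y => by
        rw [Real.coe_toNNReal _ (by positivity), div_mul_eq_mul_div, le_div_iff₀ hb, mul_comm]
        have := hvp p q hp hq y
        rwa [abs_mul, abs_of_pos hb] at this)
    have h : IsDoubledMax uε u v b (b ^ 3) β γ α l ω N T K x y w p t s := ⟨hp, ht, hs, hle⟩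
    have htT := h.left_lt hl0 hα0 hT hω hN0 hωN huε
    have hsT := h.right_lt hα0 hT hω hN0 hωN hu
    have hxy := h.norm_sub_le hK.le hb hu
    -- At this competitor, with `p = 0` and `w = x₀ / ε`, all quadratic penalties vanish.
    have hbase := hle x₀ x₀ ((b ^ 3)⁻¹ • x₀) 0 t₀ t₀ (by simpa using hK.le) ht₀ ht₀
    have hzero : (0 : ℝ) ∈ Icc 0 T := ⟨le_rfl, hT.le⟩
    have hbdry : uε x t - u y s - (2 * α)⁻¹ * (t - s) ^ 2 ≤ K ^ 2 * b + ω := by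
      have hquad : ∀ r : ℝ, K * r - (2 * α)⁻¹ * r ^ 2 ≤ ω := fun r => by
        have h1 : ω - (K * r - (2 * α)⁻¹ * r ^ 2) = (2 * α)⁻¹ * (r - α * K) ^ 2 := by
          have : ω = K ^ 2 * α / 2 := by rw [hαK]; ring
          rw [this]
          field_simp
          ring
        have h2 : 0 ≤ (2 * α)⁻¹ * (r - α * K) ^ 2 := by positivity
        linarith
      have hKxy := mul_le_mul_of_nonneg_left hxy hK.le
      rcases ht.1.eq_or_lt with ht0 | ht0
      · have h1 := (abs_le.1 (hu x y 0 hzero s hs)).2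
        rw [zero_sub, abs_neg, abs_of_nonneg hs.1] at h1
        have h2 := hquad s
        rw [← ht0, h0, zero_sub, neg_sq]
        linarith
      · rcases hs.1.eq_or_lt with hs0 | hs0
        · have h1 := (abs_le.1 (huε x y t ht 0 hzero)).2
          rw [sub_zero, abs_of_nonneg ht.1] at h1
          have h2 := hquad t
          rw [← hs0, ← h0, sub_zero]
          linarith
        · exfalso
          have := h.slope_le hK hb hb1 hM hβ0 hβ1 hγ0 hω hN0 huε hu hsub hsup hvp hvsup hvE hFl
            hFbar hmod (by linarith) hγθ ht0 htT hs0 hsT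
          linarith
    simp only [doubled] at hbase
    have e1 := (abs_le.1 (hvb' p hp w)).1
    have e2 := (abs_le.1 (hvb' 0 (by simpa using hK.le) ((b ^ 3)⁻¹ • x₀))).2
    have e3 : b ^ 3 • (b ^ 3)⁻¹ • x₀ = x₀ := by
      rw [smul_smul, mul_inv_cancel₀ (by positivity), one_smul]
    rw [e3, smul_zero, add_zero, sub_self, sub_self, norm_zero] at hbase
    have e4 : ω * Real.exp (N * (t₀ - T)) ≤ ω * 1 := by
      refine mul_le_mul_of_nonneg_left ?_ hω.le
      rw [Real.exp_le_one_iff]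
      exact mul_nonpos_of_nonneg_of_nonpos hN0.le (by linarith [ht₀.2])
    have e5 : l * t₀ ≤ l * T := mul_le_mul_of_nonneg_left ht₀.2 hl0
    have e6 : 0 ≤ l * t := mul_nonneg hl0 ht.1
    have e7 : 0 ≤ (2 * b)⁻¹ * ‖x - y‖ ^ 2 := by positivity
    have e8 : 0 ≤ (2 * b ^ 2)⁻¹ * ‖x - (y + b • p)‖ ^ 2 := by positivity
    have e9 : 0 ≤ (2 * γ)⁻¹ * ‖x - b ^ 3 • w‖ ^ 2 := by positivity
    have e10 : 0 ≤ β * smoothDist 1 0 x := mul_nonneg hβ0.le (Real.sqrt_nonneg _)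
    have e11 : 0 ≤ ω * Real.exp (N * (t - T)) := by positivity
    have e12 : 0 ≤ ω * Real.exp (N * (s - T)) := by positivity
    have e13 : l * T = (8 * M ^ 2 * b + E) * T + 2 * ω * T := by rw [hl]; ring
    linarith
  have hlim : Tendsto (fun ω : ℝ => (K ^ 2 * b + 2 * M * b ^ 2 + (8 * M ^ 2 * b + E) * T) +
      ω * (4 + 2 * T)) (𝓝[>] 0)
      (𝓝 (K ^ 2 * b + 2 * M * b ^ 2 + (8 * M ^ 2 * b + E) * T)) := by
    have : Continuous fun ω : ℝ => (K ^ 2 * b + 2 * M * b ^ 2 + (8 * M ^ 2 * b + E) * T) +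
      ω * (4 + 2 * T) := by fun_prop
    have h := this.tendsto 0
    simp only [zero_mul, add_zero] at h
    exact h.mono_left nhdsWithin_le_nhds
  exact ge_of_tendsto hlim (eventually_nhdsWithin_of_forall fun ω hω => key ω hω)

/-! ### Homogenization -/

section

variable {H : Rd d → Rd d → ℝ} {v : ℝ → Rd d → Rd d → ℝ} {K : ℝ}

/-- Quantitative convergence of the approximate cell problem. -/
lemma abs_add_effectiveHam_le_eta (hcont : Continuous fun q : Rd d × Rd d => H q.1 q.2)
    (hreg : IsRegular H) (hcoer : IsCoercive H) (hd : 0 < d)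
    (hv : ∀ δ : ℝ, 0 < δ → ∀ p, IsCellSolution H δ p (v δ p)) (hK : 0 < K) {δ : ℝ} (hδ : 0 < δ)
    {p : Rd d} (hp : ‖p‖ ≤ K) (y : Rd d) :
    |δ * v δ p y + effectiveHam v p| ≤ 3 * eta H (gradBound H K) δ := by
  have hL : 0 < gradBound H K := hK.trans_le (le_gradBound hcont hreg hcoer hd hK)
  -- The oscillation bound `12 * s` is three times the `4 * s` appearing in `eta`.
  have h := le_eta hreg hL hδ (c := |δ * v δ p y + effectiveHam v p| / 3) fun s hs hrho => by
    have := abs_add_effectiveHam_le hreg hcoer hv hδ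
      ((hv δ hδ p).osc_le hcont hreg hcoer hd hK hδ hp hs hrho) y
    linarith
  linarith

/-- Uniform local bounds for the Hamiltonian and the solutions of the cell problem. -/
lemma exists_cell_bounds (hcont : Continuous fun q : Rd d × Rd d => H q.1 q.2)
    (hreg : IsRegular H) (hcoer : IsCoercive H)
    (hv : ∀ δ : ℝ, 0 < δ → ∀ p, IsCellSolution H δ p (v δ p)) (hK : 0 < K) :
    ∃ M : ℝ, 0 ≤ M ∧
      (∀ p ∈ ball (0 : Rd d) (3 * K + 2), ∀ q ∈ ball (0 : Rd d) (3 * K + 2), ∀ y,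
        |H p y - H q y| ≤ M * ‖p - q‖) ∧
      (∀ δ, 0 < δ → ∀ p, ‖p‖ ≤ K → ∀ y, |δ * v δ p y| ≤ M) ∧
      (∀ δ, 0 < δ → ∀ p q, ‖p‖ ≤ K → ‖q‖ ≤ K → ∀ y,
        |δ * (v δ p y - v δ q y)| ≤ M * ‖p - q‖) := by
  set L := gradBound H K with hL
  have hL0 : 0 ≤ L := (norm_nonneg (0 : Rd d)).trans (norm_le_gradBound hreg hcoer (y := 0)
    (le_iSup_ball hcont hreg hK (by simpa using hK.le) 0))
  -- The radius covers the shifted slopes `r + (q - p)`, of norm at most `L + 2 * K`, as well as the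
  -- ball of radius `3 * K + 2` used in the doubling.
  obtain ⟨M, hM⟩ := (hreg (L + 3 * K + 2) (by positivity)).2
  have hM0 : 0 ≤ M := (abs_nonneg _).trans ((hM 0).1 0 (mem_ball_self (by positivity)))
  have hmem : ∀ {p : Rd d} {r : ℝ}, ‖p‖ ≤ r → r < L + 3 * K + 2 →
      p ∈ ball (0 : Rd d) (L + 3 * K + 2) := fun h1 h2 => by
    rw [mem_ball_zero_iff]; exact h1.trans_lt h2
  have hsub : ball (0 : Rd d) (3 * K + 2) ⊆ ball (0 : Rd d) (L + 3 * K + 2) :=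
    ball_subset_ball (by linarith)
  have hslope : ∀ δ, 0 < δ → ∀ p q : Rd d, ‖p‖ ≤ K → ‖q‖ ≤ K → ∀ y,
      δ * (v δ p y - v δ q y) ≤ M * ‖p - q‖ := by
    intro δ hδ p q hp hq y
    refine (hv δ hδ p).sub_le_of_slope hreg hcoer hδ (hv δ hδ q)
      (fun y => le_iSup_ball hcont hreg hK hp y)
      (fun r y h => norm_le_gradBound hreg hcoer h) (fun r hr z => ?_) y
    have h1 : ‖r + (q - p)‖ ≤ L + 2 * K := by
      have e1 := norm_add_le r (q - p)
      have e2 := norm_sub_le q p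
      linarith
    have h2 := (abs_le.1 ((hM z).2 _ (hmem h1 (by linarith)) _ (hmem hr (by linarith)))).2
    rw [add_sub_cancel_left, norm_sub_rev] at h2
    linarith
  refine ⟨M, hM0, fun p hp q hq y => (hM y).2 p (hsub hp) q (hsub hq), ?_, ?_⟩
  · intro δ hδ p hp
    exact (hv δ hδ p).abs_mul_le hreg hcoer hδ fun y => (hM y).1 p (hmem hp (by linarith))
  · intro δ hδ p q hp hq y
    have h1 := hslope δ hδ p q hp hq y
    have h2 := hslope δ hδ q p hq hp y
    rw [norm_sub_rev] at h2
    rw [abs_le]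
    constructor <;> linarith

lemma abs_effectiveHam_sub_le (hcont : Continuous fun q : Rd d × Rd d => H q.1 q.2)
    (hreg : IsRegular H) (hcoer : IsCoercive H) (hd : 0 < d) (hap : IsAlmostPeriodic H)
    (hv : ∀ δ : ℝ, 0 < δ → ∀ p, IsCellSolution H δ p (v δ p)) (hK : 0 < K) {c : ℝ}
    {p q : Rd d} (hp : ‖p‖ ≤ K) (hq : ‖q‖ ≤ K)
    (hc : ∀ δ, 0 < δ → |δ * (v δ p 0 - v δ q 0)| ≤ c) :
    |effectiveHam v p - effectiveHam v q| ≤ c := by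
  have hL : 0 < gradBound H K := hK.trans_le (le_gradBound hcont hreg hcoer hd hK)
  have hlim : Tendsto (fun δ => c + 6 * eta H (gradBound H K) δ) (𝓝[>] 0) (𝓝 c) := by
    simpa using ((hap.tendsto_eta hL).const_mul 6).const_add c
  refine ge_of_tendsto hlim (eventually_nhdsWithin_of_forall fun δ (hδ : 0 < δ) => ?_)
  have h1 := abs_le.1 (abs_add_effectiveHam_le_eta hcont hreg hcoer hd hv hK hδ hp 0)
  have h2 := abs_le.1 (abs_add_effectiveHam_le_eta hcont hreg hcoer hd hv hK hδ hq 0)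
  have h3 := abs_le.1 (hc δ hδ)
  rw [abs_le]
  constructor <;> linarith [h1.1, h1.2, h2.1, h2.2, h3.1, h3.2]

lemma continuous_effectiveHam (hcont : Continuous fun q : Rd d × Rd d => H q.1 q.2)
    (hreg : IsRegular H) (hcoer : IsCoercive H) (hd : 0 < d) (hap : IsAlmostPeriodic H)
    (hv : ∀ δ : ℝ, 0 < δ → ∀ p, IsCellSolution H δ p (v δ p)) :
    Continuous (effectiveHam v) := by
  rw [continuous_iff_continuousAt]
  intro p₀
  have hK : 0 < ‖p₀‖ + 1 := by positivity
  obtain ⟨M, hM0, -, -, hM⟩ := exists_cell_bounds hcont hreg hcoer hv hK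
  have hlip : LipschitzOnWith M.toNNReal (effectiveHam v) (closedBall 0 (‖p₀‖ + 1)) := by
    refine LipschitzOnWith.of_dist_le_mul fun p hp q hq => ?_
    rw [mem_closedBall_zero_iff] at hp hq
    rw [Real.dist_eq, dist_eq_norm, Real.coe_toNNReal _ hM0]
    exact abs_effectiveHam_sub_le hcont hreg hcoer hd hap hv hK hp hq
      fun δ hδ => hM δ hδ p q hp hq 0
  exact hlip.continuousOn.continuousAt (closedBall_mem_nhds_of_mem (by simp))

lemma isEffectiveHamiltonian_effectiveHam
    (hcont : Continuous fun q : Rd d × Rd d => H q.1 q.2)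
    (hreg : IsRegular H) (hcoer : IsCoercive H) (hd : 0 < d) (hap : IsAlmostPeriodic H)
    (hv : ∀ δ : ℝ, 0 < δ → ∀ p, IsCellSolution H δ p (v δ p)) :
    IsEffectiveHamiltonian H (effectiveHam v) := by
  intro p
  refine ⟨fun δ => v δ p, fun δ hδ => hv δ hδ p, ?_⟩
  have hK : 0 < ‖p‖ + 1 := by positivity
  have hL : 0 < gradBound H (‖p‖ + 1) :=
    hK.trans_le (le_gradBound hcont hreg hcoer hd hK)
  rw [Metric.tendstoUniformly_iff]
  intro ω hω
  filter_upwards [(hap.tendsto_eta hL).eventually_lt_const (u := ω / 3) (by positivity),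
    self_mem_nhdsWithin] with δ h1 (hδ : 0 < δ) y
  have h2 := abs_add_effectiveHam_le_eta hcont hreg hcoer hd hv hK hδ (p := p) (by linarith) y
  rw [dist_comm, Real.dist_eq, sub_neg_eq_add]
  linarith

/-- The error estimate for almost periodic Hamiltonians. -/
theorem exists_rate (hcont : Continuous fun q : Rd d × Rd d => H q.1 q.2)
    (hreg : IsRegular H) (hcoer : IsCoercive H) (hd : 0 < d) (hap : IsAlmostPeriodic H)
    (hv : ∀ δ : ℝ, 0 < δ → ∀ p, IsCellSolution H δ p (v δ p)) (hK : 0 < K) :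
    ∃ C : ℝ, 0 < C ∧ ∀ T : ℝ, 1 ≤ T → ∀ ε : ℝ, 0 < ε →
      ∀ (u₀ : Rd d → ℝ) (uε u : Rd d → ℝ → ℝ),
        IsSolutionPair H (effectiveHam v) K T ε u₀ uε u → ∀ x : Rd d, ∀ t ∈ Icc (0 : ℝ) T,
          |uε x t - u x t| ≤
            C * T * (ε ^ (1 / 3 : ℝ) + eta H (gradBound H K) (ε ^ (1 / 3 : ℝ))) := by
  obtain ⟨M, hM0, hFl, hvb, hvp⟩ := exists_cell_bounds hcont hreg hcoer hv hK
  refine ⟨K ^ 2 + 2 * M + 8 * M ^ 2 + 3 + 2 * K, by positivity, ?_⟩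
  intro T hT ε hε u₀ uε u hpair x t ht
  set b : ℝ := ε ^ (1 / 3 : ℝ) with hbdef
  have hb : 0 < b := Real.rpow_pos_of_pos hε _
  have hb3 : b ^ 3 = ε := by
    rw [hbdef, ← Real.rpow_natCast, ← Real.rpow_mul hε.le]
    norm_num
  set η := eta H (gradBound H K) b with hη
  have hη0 : 0 ≤ η := eta_nonneg _ _ _
  have hT0 : 0 < T := by linarith
  have h0 : ∀ x, uε x 0 = u x 0 := fun x => by rw [hpair.initial_eps, hpair.initial_hom]
  have hTb : 0 ≤ T * b := by positivity
  have hTη : 0 ≤ T * η := by positivity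
  -- For `b ≥ 1` the common initial datum and the time-Lipschitz bounds already give an error of at
  -- most `2 * K * T`.
  rcases le_total b 1 with hb1 | hb1
  · have herr : ∀ p : Rd d, ‖p‖ ≤ K → ∀ y, |b * v b p y + effectiveHam v p| ≤ 3 * η :=
      fun p hp y => abs_add_effectiveHam_le_eta hcont hreg hcoer hd hv hK hb hp y
    have hbar : ∀ p q : Rd d, ‖p‖ ≤ K → ‖q‖ ≤ K →
        |effectiveHam v p - effectiveHam v q| ≤ M * ‖p - q‖ := fun p q hp hq =>
      abs_effectiveHam_sub_le hcont hreg hcoer hd hap hv hK hp hq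
        fun δ hδ => hvp δ hδ p q hp hq 0
    have hFu := (hreg (3 * K + 2) (by positivity)).1
    have hsubε : IsHJSub (fun p x => H p ((b ^ 3)⁻¹ • x)) T uε := by
      rw [hb3]; exact hpair.solution_eps.subsolution
    have hsupε : IsHJSuper (fun p x => H p ((b ^ 3)⁻¹ • x)) T uε := by
      rw [hb3]; exact hpair.solution_eps.supersolution
    have hsub : IsHJSub (fun p _ => effectiveHam v p) T u := hpair.solution_hom.subsolution
    have hsup : IsHJSuper (fun p _ => effectiveHam v p) T u := hpair.solution_hom.supersolution
    have hupper := sub_le_of_correctors hK hb hb1 hM0 (by positivity : 0 ≤ 3 * η) hT0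
      hpair.lipschitz_eps hpair.lipschitz_hom h0 hsubε hsup
      (fun p _ => (hv b hb p).uniformContinuous.continuous) (hvb b hb) (hvp b hb)
      (fun p _ => (hv b hb p).isCellSuper) (fun p hp y => (abs_le.1 (herr p hp y)).2) hFl hFu hbar
      x ht
    -- The reflected problem uses the subsolution property of the same cell solutions, now at slope
    -- `-p`.
    have hlower := sub_le_of_correctors (F := fun p y => -H (-p) y)
      (Fbar := fun p => -effectiveHam v (-p)) (v := fun p y => -v b (-p) y)
      hK hb hb1 hM0 (by positivity : 0 ≤ 3 * η) hT0
      hpair.lipschitz_eps.neg hpair.lipschitz_hom.neg (fun x => by rw [h0]) hsupε.neg hsub.neg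
      (fun p _ => (hv b hb (-p)).uniformContinuous.continuous.neg)
      (fun p hp y => by
        rw [mul_neg, abs_neg]
        exact hvb b hb (-p) (by rwa [norm_neg]) y)
      (fun p q hp hq y => by
        have := hvp b hb (-p) (-q) (by rwa [norm_neg]) (by rwa [norm_neg]) y
        rw [neg_sub_neg, norm_sub_rev] at this
        rwa [neg_sub_neg, ← neg_sub, mul_neg, abs_neg])
      (fun p _ => by
        convert (hv b hb (-p)).isCellSub.neg using 1
        funext q y
        simp only [cellHam, neg_add])
      (fun p hp y => by
        have := (abs_le.1 (herr (-p) (by rwa [norm_neg]) y)).1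
        linarith)
      (fun p hp q hq y => by
        rw [mem_ball_zero_iff] at hp hq
        have := hFl (-p) (by rwa [mem_ball_zero_iff, norm_neg]) (-q)
          (by rwa [mem_ball_zero_iff, norm_neg]) y
        rw [neg_sub_neg, norm_sub_rev] at this
        rwa [neg_sub_neg, abs_sub_comm])
      (by
        rw [Metric.uniformContinuousOn_iff] at hFu ⊢
        intro ω hω
        obtain ⟨θ, hθ, h⟩ := hFu ω hω
        have hmem : ∀ a ∈ (ball 0 (3 * K + 2) ×ˢ univ : Set (Rd d × Rd d)),
            (-a.1, a.2) ∈ (ball 0 (3 * K + 2) ×ˢ univ : Set (Rd d × Rd d)) := fun a ha => by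
          refine ⟨?_, mem_univ _⟩
          simpa using ha.1
        refine ⟨θ, hθ, fun a ha c hc hac => ?_⟩
        rw [dist_neg_neg]
        refine h _ (hmem a ha) _ (hmem c hc) ?_
        rw [Prod.dist_eq] at hac ⊢
        rwa [dist_neg_neg])
      (fun p q hp hq => by
        have := hbar (-p) (-q) (by rwa [norm_neg]) (by rwa [norm_neg])
        rw [neg_sub_neg, norm_sub_rev] at this
        rwa [neg_sub_neg, abs_sub_comm])
      x ht
    have hfin : K ^ 2 * b + 2 * M * b ^ 2 + (8 * M ^ 2 * b + 3 * η) * T ≤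
        (K ^ 2 + 2 * M + 8 * M ^ 2 + 3 + 2 * K) * T * (b + η) := by
      have hbT : b ≤ T * b := by nlinarith
      have e1 : K ^ 2 * b ≤ K ^ 2 * (T * b) := by gcongr
      have e2 : 2 * M * b ^ 2 ≤ 2 * M * (T * b) := by
        refine mul_le_mul_of_nonneg_left ?_ (by positivity)
        nlinarith
      have e3 : 0 ≤ (3 + 2 * K) * (T * b) := by positivity
      have e4 : 0 ≤ (K ^ 2 + 2 * M + 8 * M ^ 2 + 2 * K) * (T * η) := by positivity
      linarith
    rw [abs_le]
    constructor <;> linarith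
  · have hz : (0 : ℝ) ∈ Icc 0 T := ⟨le_rfl, hT0.le⟩
    have a1 := abs_le.1 (hpair.lipschitz_eps.time ht hz x)
    have a2 := abs_le.1 (hpair.lipschitz_hom.time ht hz x)
    have a3 := h0 x
    rw [sub_zero, abs_of_nonneg ht.1] at a1 a2
    have a4 := mul_le_mul_of_nonneg_left ht.2 hK.le
    have hfin : 2 * K * T ≤ (K ^ 2 + 2 * M + 8 * M ^ 2 + 3 + 2 * K) * T * (b + η) := by
      have e1 : 2 * K * T ≤ 2 * K * (T * b) :=
        mul_le_mul_of_nonneg_left (by nlinarith) (by positivity)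
      have e2 : 0 ≤ (K ^ 2 + 2 * M + 8 * M ^ 2 + 3) * (T * b) := by positivity
      have e3 : 0 ≤ (K ^ 2 + 2 * M + 8 * M ^ 2 + 3 + 2 * K) * (T * η) := by positivity
      linarith
    rw [abs_le]
    constructor <;> linarith [a1.1, a1.2, a2.1, a2.2]

end

end HJ

end

theorem proposition7p4 (d : ℕ) (hd : 0 < d)
    (H : HJ.Rd d → HJ.Rd d → ℝ)
    (hcont : Continuous fun q : HJ.Rd d × HJ.Rd d => H q.1 q.2)
    (hreg : HJ.IsRegular H) (hcoer : HJ.IsCoercive H) :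
    (HJ.IsPeriodic H → HJ.IsAlmostPeriodic H) ∧
    (HJ.IsAlmostPeriodic H →
      (∀ δ : ℝ, 0 < δ → ∀ p : HJ.Rd d, ∃! v : HJ.Rd d → ℝ, HJ.IsCellSolution H δ p v) ∧
      ∃ Hbar : HJ.Rd d → ℝ,
        Continuous Hbar ∧ HJ.IsEffectiveHamiltonian H Hbar ∧
        (∀ K : ℝ, 0 < K → Filter.Tendsto (HJ.eta H (HJ.gradBound H K))
          (nhdsWithin 0 (Set.Ioi 0)) (nhds 0)) ∧
        (∀ K : ℝ, 0 < K → ∃ C : ℝ, 0 < C ∧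
          ∀ T : ℝ, 1 ≤ T → ∀ ε : ℝ, 0 < ε →
          ∀ (u₀ : HJ.Rd d → ℝ) (uε u : HJ.Rd d → ℝ → ℝ),
            HJ.IsSolutionPair H Hbar K T ε u₀ uε u →
            ∀ x : HJ.Rd d, ∀ t ∈ Set.Icc (0 : ℝ) T,
              |uε x t - u x t| ≤
                C * T * (ε ^ (1 / 3 : ℝ) + HJ.eta H (HJ.gradBound H K) (ε ^ (1 / 3 : ℝ)))) ∧
        (HJ.IsPeriodic H → ∀ K : ℝ, 0 < K → ∃ C : ℝ, 0 < C ∧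
          ∀ T : ℝ, 1 ≤ T → ∀ ε : ℝ, 0 < ε →
          ∀ (u₀ : HJ.Rd d → ℝ) (uε u : HJ.Rd d → ℝ → ℝ),
            HJ.IsSolutionPair H Hbar K T ε u₀ uε u →
            ∀ x : HJ.Rd d, ∀ t ∈ Set.Icc (0 : ℝ) T,
              |uε x t - u x t| ≤ C * T * ε ^ (1 / 3 : ℝ))) := by
  refine ⟨fun hper => hper.isAlmostPeriodic hreg, fun hap => ?_⟩
  have hex := fun (δ : ℝ) (hδ : 0 < δ) (p : HJ.Rd d) =>
    HJ.existsUnique_isCellSolution hcont hreg hcoer hδ p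
  have hv : ∃ v : ℝ → HJ.Rd d → HJ.Rd d → ℝ,
      ∀ δ : ℝ, 0 < δ → ∀ p, HJ.IsCellSolution H δ p (v δ p) := by
    choose v hv _ using hex
    -- The value for `δ ≤ 0` is irrelevant; a total function avoids carrying positivity proofs.
    refine ⟨fun δ p => if hδ : 0 < δ then v δ hδ p else 0, fun δ hδ p => ?_⟩
    simpa only [dif_pos hδ] using hv δ hδ p
  obtain ⟨v, hv⟩ := hv
  have hL : ∀ K : ℝ, 0 < K → 0 < HJ.gradBound H K := fun K hK =>
    hK.trans_le (HJ.le_gradBound hcont hreg hcoer hd hK)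
  refine ⟨hex, HJ.effectiveHam v, HJ.continuous_effectiveHam hcont hreg hcoer hd hap hv,
    HJ.isEffectiveHamiltonian_effectiveHam hcont hreg hcoer hd hap hv,
    fun K hK => hap.tendsto_eta (hL K hK),
    fun K hK => HJ.exists_rate hcont hreg hcoer hd hap hv hK, fun hper K hK => ?_⟩
  obtain ⟨C, hC, hrate⟩ := HJ.exists_rate hcont hreg hcoer hd hap hv hK
  have hLK := hL K hK
  -- The linear bound on `eta` in the periodic case turns `ε^{1/3} + η_L(ε^{1/3})` into a multiple
  -- of `ε^{1/3}`.
  refine ⟨C * (1 + 4 * (HJ.gradBound H K * (√d + 1))), by positivity, ?_⟩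
  intro T hT ε hε u₀ uε u hpair x t ht
  refine (hrate T hT ε hε u₀ uε u hpair x t ht).trans ?_
  have hb : 0 < ε ^ (1 / 3 : ℝ) := Real.rpow_pos_of_pos hε _
  have h1 := hper.eta_le hLK hb
  have h2 : 0 ≤ C * T := by positivity
  have h3 := mul_le_mul_of_nonneg_left h1 h2
  linarith
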